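/- A digraph here is finite, and loops and multiarcs are allowed: it consists of a set of nodes and a finite multiset of arcs, i.e. ordered pairs (tail, head) of nodes. It is $k$-regular if every node is the tail of exactly $k$ arcs and the head of exactly $k$ arcs, counted with multiplicity (so a loop contributes one to both the outdegree and the indegree of its node). An unlabeled digraph is an isomorphism class of digraphs under bijections of the nodes that preserve the multiset of arcs. The components of a digraph are its weakly connected components, i.e. the connected components of the simple graph obtained by forgetting directions, multiplicities and loops. Let $U_2(n)$ be the number of unlabeled $2$-regular digraphs on $n$ nodes, and $U_2(n,c)$ the number of those with exactly $c$ components. Then for $1\le n\le 9$ and $1\le c\le 9$ the values of $U_2(n,c)$ and $U_2(n)$ are (blank entries are $0$) $$\begin{array}{r|rrrrrrrrr|r} n\backslash c & 1 & 2 & 3 & 4 & 5 & 6 & 7 & 8 & 9 & U_2(n)\\ \hline 1 & 1 &&&&&&&&& 1\\ 2 & 2 & 1 &&&&&&&& 3\\ 3 & 5 & 2 & 1 &&&&&&& 8\\ 4 & 14 & 8 & 2 & 1 &&&&&& 25\\ 5 & 50 & 24 & 8 & 2 & 1 &&&&& 85\\ 6 & 265 & 93 & 28 & 8 & 2 & 1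 &&&& 397\\ 7 & 1601 & 435 & 108 & 28 & 8 & 2 & 1 &&& 2183\\ 8 & 11984 & 2486 & 507 & 113 & 28 & 8 & 2 & 1 && 15129\\ 9 & 101884 & 17211 & 2811 & 527 & 113 & 28 & 8 & 2 & 1 & 122585 \end{array}$$ and in each row $U_2(n)=\sum_{c=1}^{n}U_2(n,c)$. Moreover, for every $n\ge 0$, sending a digraph with nodes labeled $1,\dots,n$ to its adjacency matrix (whose entry in row $r$ and column $c$ is the number of arcs from $r$ to $c$) induces a bijection from the unlabeled $2$-regular digraphs on $n$ nodes onto the orbits of the $n\times n$ matrices with nonnegative integer entries and all row and column sums equal to $2$ under simultaneous permutations of rows and columns. In particular, the number of these orbits is $1, 3, 8, 25, 85, 397, 2183, 15129, 122585$ for $n=1,\dots,9$. -/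

import Mathlib

/-- A digraph on the node set `V`, with loops and multiarcs allowed: a finite multiset of arcs,
each arc being recorded as the pair `(tail, head)`. -/
@[ext]
structure MultiDigraph (V : Type*) where
  /-- The multiset of arcs `(tail, head)`. -/
  arcs : Multiset (V × V)

namespace MultiDigraph

variable {V W : Type*}

/-- The number of arcs whose tail is `v`. -/
def outdegree [DecidableEq V] (D : MultiDigraph V) (v : V) : ℕ :=
  D.arcs.countP (fun a => a.1 = v)

/-- The number of arcs whose head is `v`. -/
def indegree [DecidableEq V] (D : MultiDigraph V) (v : V) : ℕ :=
  D.arcs.countP (fun a => a.2 = v)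

/-- `k`-regularity: every node has outdegree `k` and indegree `k`. -/
def IsRegular [DecidableEq V] (D : MultiDigraph V) (k : ℕ) : Prop :=
  ∀ v, D.outdegree v = k ∧ D.indegree v = k

/-- The adjacency matrix: the entry `(r, c)` is the number of arcs from `r` to `c`. -/
def adjMatrix [DecidableEq V] (D : MultiDigraph V) : Matrix V V ℕ :=
  Matrix.of fun r c => D.arcs.count (r, c)

/-- The underlying simple graph: directions, multiplicities and loops are forgotten. -/
def underlyingGraph (D : MultiDigraph V) : SimpleGraph V :=
  SimpleGraph.fromRel fun u v => (u, v) ∈ D.arcs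

/-- The number of weakly connected components. -/
noncomputable def numComponents (D : MultiDigraph V) : ℕ :=
  Nat.card D.underlyingGraph.ConnectedComponent

/-- Relabelling of the nodes along a bijection. -/
def relabel (e : V ≃ W) (D : MultiDigraph V) : MultiDigraph W :=
  ⟨D.arcs.map (Prod.map e e)⟩

/-- Two digraphs are isomorphic if one is obtained from the other by relabelling the nodes. -/
def Isomorphic (D : MultiDigraph V) (E : MultiDigraph W) : Prop :=
  ∃ e : V ≃ W, D.relabel e = E

theorem Isomorphic.refl (D : MultiDigraph V) : D.Isomorphic D :=
  ⟨Equiv.refl V, by ext1; simp [relabel]⟩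

theorem Isomorphic.symm {D : MultiDigraph V} {E : MultiDigraph W} (h : D.Isomorphic E) :
    E.Isomorphic D := by
  obtain ⟨e, rfl⟩ := h
  refine ⟨e.symm, ?_⟩
  ext1
  simp [relabel, Multiset.map_map, Prod.map]

theorem Isomorphic.trans {X : Type*} {D : MultiDigraph V} {E : MultiDigraph W}
    {F : MultiDigraph X} (h : D.Isomorphic E) (h' : E.Isomorphic F) : D.Isomorphic F := by
  obtain ⟨e, rfl⟩ := h
  obtain ⟨f, rfl⟩ := h'
  refine ⟨e.trans f, ?_⟩
  ext1
  simp [relabel, Multiset.map_map, Prod.map]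

theorem Isomorphic.numComponents_eq {D : MultiDigraph V} {E : MultiDigraph W}
    (h : D.Isomorphic E) : D.numComponents = E.numComponents := by
  obtain ⟨e, rfl⟩ := h
  have hmem : ∀ u v, (e u, e v) ∈ (D.relabel e).arcs ↔ (u, v) ∈ D.arcs := by
    intro u v
    simp [relabel]
  have φ : D.underlyingGraph ≃g (D.relabel e).underlyingGraph :=
    ⟨e, by intro u v; simp [underlyingGraph, hmem]⟩
  exact Nat.card_congr φ.connectedComponentEquiv

end MultiDigraph

/-- Labeled `k`-regular digraphs on the nodes `0, …, n - 1`. -/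
abbrev LabeledRegularDigraph (k n : ℕ) : Type :=
  {D : MultiDigraph (Fin n) // D.IsRegular k}

/-- Isomorphism as an equivalence relation on labeled `k`-regular digraphs. -/
instance LabeledRegularDigraph.isoSetoid (k n : ℕ) : Setoid (LabeledRegularDigraph k n) where
  r D E := D.1.Isomorphic E.1
  iseqv := ⟨fun D => .refl D.1, fun h => h.symm, fun h h' => h.trans h'⟩

/-- Unlabeled `k`-regular digraphs on `n` nodes: isomorphism classes of labeled ones. -/
abbrev UnlabeledRegularDigraph (k n : ℕ) : Type :=
  Quotient (LabeledRegularDigraph.isoSetoid k n)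

/-- The number of weakly connected components of an unlabeled digraph. -/
noncomputable def UnlabeledRegularDigraph.numComponents {k n : ℕ} :
    UnlabeledRegularDigraph k n → ℕ :=
  Quotient.lift (fun D => D.1.numComponents)
    fun _ _ h => MultiDigraph.Isomorphic.numComponents_eq h

/-- The number `U_k(n)` of unlabeled `k`-regular digraphs on `n` nodes. -/
noncomputable def numUnlabeled (k n : ℕ) : ℕ :=
  Nat.card (UnlabeledRegularDigraph k n)

/-- The number `U_k(n, c)` of unlabeled `k`-regular digraphs on `n` nodes with exactly `c`
weakly connected components. -/
noncomputable def numUnlabeledComponents (k n c : ℕ) : ℕ :=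
  Nat.card {x : UnlabeledRegularDigraph k n // x.numComponents = c}

/-- The `n × n` matrices with nonnegative integer entries all of whose row sums and column sums
are equal to `k`. -/
abbrev RegularMatrix (k n : ℕ) : Type :=
  {A : Matrix (Fin n) (Fin n) ℕ // (∀ i, ∑ j, A i j = k) ∧ ∀ j, ∑ i, A i j = k}

/-- Permutations act by permuting rows and columns simultaneously:
`(σ • A) (σ i) (σ j) = A i j`. -/
instance RegularMatrix.permAction (k n : ℕ) :
    MulAction (Equiv.Perm (Fin n)) (RegularMatrix k n) where
  smul σ A := ⟨A.1.submatrix σ.symm σ.symm, by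
    refine ⟨fun i => ?_, fun j => ?_⟩
    · exact (Equiv.sum_comp σ.symm fun j => A.1 (σ.symm i) j).trans (A.2.1 _)
    · exact (Equiv.sum_comp σ.symm fun i => A.1 i (σ.symm j)).trans (A.2.2 _)⟩
  one_smul _ := rfl
  mul_smul _ _ _ := rfl

/-- Orbits of regular matrices under simultaneous permutations of rows and columns. -/
abbrev RegularMatrixOrbit (k n : ℕ) : Type :=
  MulAction.orbitRel.Quotient (Equiv.Perm (Fin n)) (RegularMatrix k n)

namespace MultiDigraph

theorem sum_adjMatrix_row {n : ℕ} (D : MultiDigraph (Fin n)) (i : Fin n) :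
    ∑ j, D.adjMatrix i j = D.outdegree i := by
  obtain ⟨s⟩ := D
  induction s using Multiset.induction_on with
  | empty => simp [adjMatrix, outdegree]
  | cons a s ih =>
    obtain ⟨u, v⟩ := a
    simp only [adjMatrix, outdegree, Matrix.of_apply, Multiset.count_cons, Multiset.countP_cons,
      Finset.sum_add_distrib] at ih ⊢
    rw [ih]
    by_cases h : u = i
    · simp [h]
    · simp [h, Ne.symm h]

theorem sum_adjMatrix_col {n : ℕ} (D : MultiDigraph (Fin n)) (j : Fin n) :
    ∑ i, D.adjMatrix i j = D.indegree j := by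
  obtain ⟨s⟩ := D
  induction s using Multiset.induction_on with
  | empty => simp [adjMatrix, indegree]
  | cons a s ih =>
    obtain ⟨u, v⟩ := a
    simp only [adjMatrix, indegree, Matrix.of_apply, Multiset.count_cons, Multiset.countP_cons,
      Finset.sum_add_distrib] at ih ⊢
    rw [ih]
    by_cases h : v = j
    · simp [h]
    · simp [h, Ne.symm h]

end MultiDigraph

/-- The adjacency matrix of a labeled `k`-regular digraph, as a matrix with all row and column
sums equal to `k`. -/
def LabeledRegularDigraph.toMatrix {k n : ℕ} (D : LabeledRegularDigraph k n) :
    RegularMatrix k n :=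
  ⟨D.1.adjMatrix, fun i => (D.1.sum_adjMatrix_row i).trans (D.2 i).1,
    fun j => (D.1.sum_adjMatrix_col j).trans (D.2 j).2⟩

/-!
A `k`-regular digraph arises by gluing `k` outgoing to `k` incoming half-arcs at every node, that
is, from a permutation `π` of `V × ι` with `|ι| = k`. Two permutations give isomorphic digraphs if
and only if they are related by `π ↦ g * π * h⁻¹`, where `g` and `h` lift a common permutation `σ`
of the nodes, so the isomorphism classes are the orbits of a finite group action. In Burnside's
lemma, `(g, h)` fixes `z` permutations if `g` and `h` are conjugate with centralizer of order `z`,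
and none otherwise, so only the cycle lengths of `g` and `h` matter. For `k = 2` the lifts are
double covers: over a cycle of `σ` of length `l`, half of the `2 ^ l` lifts consist of two cycles of
length `l`, the other half of a single cycle of length `2 * l`. This turns Burnside's lemma into a
sum over the partitions of `n`.

An unlabeled digraph is the same thing as the multiset of its components, so the numbers of all
unlabeled regular digraphs are the Euler transform of the numbers of connected ones. As the Euler
transform is injective, the totals determine the connected counts, and these determine the numbers
of digraphs with `c` components.
-/

namespace MultiDigraph

section AdjMatrix

variable {V W : Type*} [DecidableEq V] [DecidableEq W]

/-- The digraph with a given adjacency matrix. -/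
def ofAdjMatrix [Fintype V] (A : Matrix V V ℕ) : MultiDigraph V :=
  ⟨∑ p : V × V, Multiset.replicate (A p.1 p.2) p⟩

@[simp]
theorem adjMatrix_ofAdjMatrix [Fintype V] (A : Matrix V V ℕ) : (ofAdjMatrix A).adjMatrix = A := by
  ext u v
  simp [adjMatrix, ofAdjMatrix, Multiset.count_sum', Multiset.count_replicate]

theorem adjMatrix_injective : Function.Injective (adjMatrix : MultiDigraph V → Matrix V V ℕ) := by
  intro D E h
  ext1
  ext ⟨u, v⟩
  exact congrFun (congrFun h u) v

theorem adjMatrix_ne_zero {D : MultiDigraph V} {u v : V} :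
    D.adjMatrix u v ≠ 0 ↔ (u, v) ∈ D.arcs :=
  Multiset.count_ne_zero

theorem adjMatrix_relabel_submatrix (e : V ≃ W) (D : MultiDigraph V) :
    (D.relabel e).adjMatrix.submatrix e e = D.adjMatrix := by
  ext u v
  exact Multiset.count_map_eq_count' (Prod.map e e) _ (e.injective.prodMap e.injective) (u, v)

theorem relabel_eq_iff {e : V ≃ W} {D : MultiDigraph V} {E : MultiDigraph W} :
    D.relabel e = E ↔ E.adjMatrix.submatrix e e = D.adjMatrix := by
  rw [← adjMatrix_relabel_submatrix e D, ← adjMatrix_injective.eq_iff, eq_comm]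
  exact ((Matrix.reindex e.symm e.symm).injective.eq_iff
    (a := E.adjMatrix) (b := (D.relabel e).adjMatrix)).symm

theorem isomorphic_iff_adjMatrix {D : MultiDigraph V} {E : MultiDigraph W} :
    D.Isomorphic E ↔ ∃ e : V ≃ W, E.adjMatrix.submatrix e e = D.adjMatrix :=
  exists_congr fun _ => relabel_eq_iff

theorem outdegree_eq_sum_adjMatrix [Fintype V] (D : MultiDigraph V) (v : V) :
    D.outdegree v = ∑ u, D.adjMatrix v u := by
  obtain ⟨s⟩ := D
  induction s using Multiset.induction_on with
  | empty => simp [outdegree, adjMatrix]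
  | cons a s ih =>
    simp only [outdegree, adjMatrix, Matrix.of_apply, Multiset.count_cons, Multiset.countP_cons,
      Finset.sum_add_distrib] at ih ⊢
    simp [ih, Prod.ext_iff, ite_and, eq_comm (a := v)]

theorem indegree_eq_sum_adjMatrix [Fintype V] (D : MultiDigraph V) (v : V) :
    D.indegree v = ∑ u, D.adjMatrix u v := by
  obtain ⟨s⟩ := D
  induction s using Multiset.induction_on with
  | empty => simp [indegree, adjMatrix]
  | cons a s ih =>
    simp only [indegree, adjMatrix, Matrix.of_apply, Multiset.count_cons, Multiset.countP_cons,
      Finset.sum_add_distrib] at ih ⊢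
    simp [ih, Prod.ext_iff, ite_and, eq_comm (a := v)]

theorem isRegular_iff_adjMatrix [Fintype V] {D : MultiDigraph V} {k : ℕ} :
    D.IsRegular k ↔ ∀ v, ∑ u, D.adjMatrix v u = k ∧ ∑ u, D.adjMatrix u v = k := by
  simp only [IsRegular, outdegree_eq_sum_adjMatrix, indegree_eq_sum_adjMatrix]

theorem IsRegular.of_isomorphic {D : MultiDigraph V} {E : MultiDigraph W} {k : ℕ}
    (hD : D.IsRegular k) (h : D.Isomorphic E) : E.IsRegular k := by
  obtain ⟨e, rfl⟩ := h
  refine e.surjective.forall.2 fun v => ?_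
  simpa [outdegree, indegree, relabel, Multiset.countP_map, ← Multiset.countP_eq_card_filter]
    using hD v

end AdjMatrix

end MultiDigraph

theorem LabeledRegularDigraph.isomorphic_iff_mem_orbit {k n : ℕ} (D E : LabeledRegularDigraph k n) :
    D.1.Isomorphic E.1 ↔ E.toMatrix ∈ MulAction.orbit (Equiv.Perm (Fin n)) D.toMatrix := by
  rw [MultiDigraph.isomorphic_iff_adjMatrix]
  refine exists_congr fun σ => ?_
  rw [smul_eq_iff_eq_inv_smul, eq_comm]
  exact (Subtype.ext_iff (a1 := D.toMatrix) (a2 := σ⁻¹ • E.toMatrix)).symm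

theorem exists_equiv_regularMatrixOrbit (k n : ℕ) :
    ∃ f : UnlabeledRegularDigraph k n ≃ RegularMatrixOrbit k n,
      ∀ D : LabeledRegularDigraph k n,
        f (Quotient.mk (LabeledRegularDigraph.isoSetoid k n) D) =
          Quotient.mk (MulAction.orbitRel (Equiv.Perm (Fin n)) (RegularMatrix k n))
            D.toMatrix := by
  let ofMatrix (A : RegularMatrix k n) : LabeledRegularDigraph k n :=
    ⟨.ofAdjMatrix A.1, MultiDigraph.isRegular_iff_adjMatrix.2 fun v => by
      simpa using ⟨A.2.1 v, A.2.2 v⟩⟩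
  let e : LabeledRegularDigraph k n ≃ RegularMatrix k n :=
    { toFun := LabeledRegularDigraph.toMatrix
      invFun := ofMatrix
      left_inv D := Subtype.ext (MultiDigraph.adjMatrix_injective
        (MultiDigraph.adjMatrix_ofAdjMatrix _))
      right_inv A := Subtype.ext (MultiDigraph.adjMatrix_ofAdjMatrix A.1) }
  refine ⟨Quotient.congr e fun D E => ?_, fun D => rfl⟩
  exact (LabeledRegularDigraph.isomorphic_iff_mem_orbit D E).trans
    (MulAction.orbitRel_apply.symm.trans
      ⟨(MulAction.orbitRel _ _).symm, (MulAction.orbitRel _ _).symm⟩)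

open Equiv (Perm)

/-! ### Cycle lengths -/

section CycleLengths

variable {α : Type*} {β : Type*} [Fintype α] [DecidableEq α] [Fintype β] [DecidableEq β]

/-- The multiset of cycle lengths of a permutation, with a part `1` for every fixed point (unlike
`Equiv.Perm.cycleType`). -/
def cycleLengths (σ : Perm α) : Multiset ℕ :=
  σ.partition.parts

theorem cycleLengths_eq_cycleType_add (σ : Perm α) :
    cycleLengths σ = σ.cycleType + Multiset.replicate (Fintype.card α - σ.cycleType.sum) 1 := by
  rw [cycleLengths, Perm.parts_partition, Perm.sum_cycleType]

theorem sum_cycleLengths (σ : Perm α) : (cycleLengths σ).sum = Fintype.card α :=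
  σ.partition.parts_sum

theorem pos_of_mem_cycleLengths {σ : Perm α} {l : ℕ} (h : l ∈ cycleLengths σ) : 0 < l :=
  σ.partition.parts_pos h

theorem cycleLengths_eq_iff_isConj {σ τ : Perm α} :
    cycleLengths σ = cycleLengths τ ↔ IsConj σ τ := by
  rw [Perm.partition_eq_of_isConj, Nat.Partition.ext_iff, cycleLengths, cycleLengths]

theorem cycleLengths_of_isEmpty [IsEmpty α] (σ : Perm α) : cycleLengths σ = 0 := by
  simp [cycleLengths_eq_cycleType_add, Subsingleton.elim σ 1]

theorem cycleLengths_finRotate (n : ℕ) : cycleLengths (finRotate (n + 1)) = {n + 1} := by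
  rw [cycleLengths_eq_cycleType_add]
  cases n with
  | zero => simp [Subsingleton.elim (finRotate 1) 1]
  | succ n => simp [cycleType_finRotate]

theorem cycleType_permCongr (e : α ≃ β) (σ : Perm α) :
    (e.permCongr σ).cycleType = σ.cycleType := by
  rw [← Perm.cycleType_extendDomain (e.trans (Equiv.Set.univ β).symm)]
  rfl

theorem cycleLengths_permCongr (e : α ≃ β) (σ : Perm α) :
    cycleLengths (e.permCongr σ) = cycleLengths σ := by
  simp only [cycleLengths_eq_cycleType_add, cycleType_permCongr, Fintype.card_congr e]

theorem exists_permCongr_eq {σ : Perm α} {τ : Perm β} (h : cycleLengths σ = cycleLengths τ) :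
    ∃ e : α ≃ β, e.permCongr σ = τ := by
  have hcard : Fintype.card α = Fintype.card β := by
    rw [← sum_cycleLengths σ, h, sum_cycleLengths]
  let e := Fintype.equivOfCardEq hcard
  obtain ⟨c, rfl⟩ := isConj_iff.1
    (cycleLengths_eq_iff_isConj.1 ((cycleLengths_permCongr e σ).trans h))
  exact ⟨e.trans c, rfl⟩

theorem cycleType_sumCongr (σ : Perm α) (τ : Perm β) :
    (Perm.sumCongr σ τ).cycleType = σ.cycleType + τ.cycleType := by
  have hdisj : (Perm.sumCongr σ (1 : Perm β)).Disjoint (Perm.sumCongr (1 : Perm α) τ) := by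
    rintro (x | x) <;> simp
  have hl : Perm.sumCongr σ (1 : Perm β) =
      σ.extendDomain (Equiv.ofInjective _ Sum.inl_injective) := by
    ext (x | x)
    · exact (Perm.extendDomain_apply_image σ (Equiv.ofInjective _ Sum.inl_injective) x).symm
    · exact (Perm.extendDomain_apply_not_subtype _ _ (by simp)).symm
  have hr : Perm.sumCongr (1 : Perm α) τ =
      τ.extendDomain (Equiv.ofInjective _ Sum.inr_injective) := by
    ext (x | x)
    · exact (Perm.extendDomain_apply_not_subtype _ _ (by simp)).symm
    · exact (Perm.extendDomain_apply_image τ (Equiv.ofInjective _ Sum.inr_injective) x).symm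
  have hmul : Perm.sumCongr σ τ = Perm.sumCongr σ 1 * Perm.sumCongr 1 τ := by
    rw [Perm.sumCongr_mul, mul_one, one_mul]
  rw [hmul, hdisj.cycleType_mul, hl, hr, Perm.cycleType_extendDomain, Perm.cycleType_extendDomain]

theorem cycleLengths_sumCongr (σ : Perm α) (τ : Perm β) :
    cycleLengths (Perm.sumCongr σ τ) = cycleLengths σ + cycleLengths τ := by
  have hcard : Fintype.card (α ⊕ β) - (σ.cycleType + τ.cycleType).sum =
      (Fintype.card α - σ.cycleType.sum) + (Fintype.card β - τ.cycleType.sum) := by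
    have := σ.sum_cycleType_le
    have := τ.sum_cycleType_le
    rw [Fintype.card_sum, Multiset.sum_add]
    omega
  simp only [cycleLengths_eq_cycleType_add, cycleType_sumCongr, hcard, Multiset.replicate_add]
  abel

theorem exists_cycleLengths_eq (s : Multiset ℕ) (hs : ∀ l ∈ s, 0 < l) :
    ∃ σ : Perm (Fin s.sum), cycleLengths σ = s := by
  induction s using Multiset.induction_on with
  | empty => exact ⟨1, cycleLengths_of_isEmpty (α := Fin 0) 1⟩
  | cons a s ih =>
    obtain ⟨σ, hσ⟩ := ih fun l hl => hs l (Multiset.mem_cons_of_mem hl)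
    obtain ⟨n, rfl⟩ := Nat.exists_eq_succ_of_ne_zero (hs a (Multiset.mem_cons_self a s)).ne'
    rw [Multiset.sum_cons]
    refine ⟨finSumFinEquiv.permCongr (Perm.sumCongr (finRotate (n + 1)) σ), ?_⟩
    rw [cycleLengths_permCongr, cycleLengths_sumCongr, cycleLengths_finRotate, hσ,
      Multiset.singleton_add]

end CycleLengths

theorem perm_induction_on_cycles.{u}
    {motive : ∀ (α : Type u) [Fintype α] [DecidableEq α], Perm α → Prop}
    (permCongr : ∀ (α β : Type u) [Fintype α] [DecidableEq α] [Fintype β] [DecidableEq β]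
      (e : α ≃ β) (σ : Perm α), motive α σ → motive β (e.permCongr σ))
    (isEmpty : ∀ (α : Type u) [Fintype α] [DecidableEq α] [IsEmpty α] (σ : Perm α), motive α σ)
    (sumCongr : ∀ (α : Type u) [Fintype α] [DecidableEq α] (n : ℕ) (σ : Perm α),
      motive α σ → motive (Fin (n + 1) ⊕ α) (Perm.sumCongr (finRotate (n + 1)) σ))
    (α : Type u) [Fintype α] [DecidableEq α] (σ : Perm α) : motive α σ := by
  obtain ⟨s, hs⟩ : ∃ s, cycleLengths σ = s := ⟨_, rfl⟩
  induction s using Multiset.induction_on generalizing α with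
  | empty =>
    have : IsEmpty α := Fintype.card_eq_zero_iff.1 (by rw [← sum_cycleLengths σ, hs]; rfl)
    exact isEmpty α σ
  | cons a s ih =>
    have hpos : ∀ l ∈ a ::ₘ s, 0 < l := fun l hl => pos_of_mem_cycleLengths (hs ▸ hl)
    obtain ⟨n, rfl⟩ := Nat.exists_eq_succ_of_ne_zero (hpos a (Multiset.mem_cons_self a s)).ne'
    obtain ⟨τ, hτ⟩ := exists_cycleLengths_eq s fun l hl => hpos l (Multiset.mem_cons_of_mem hl)
    let τ' := Equiv.ulift.{u}.symm.permCongr τ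
    have hτ' : cycleLengths τ' = s := (cycleLengths_permCongr _ τ).trans hτ
    obtain ⟨e, rfl⟩ : ∃ e : _ ≃ α, e.permCongr (Perm.sumCongr (finRotate (n + 1)) τ') = σ :=
      exists_permCongr_eq (by
        rw [cycleLengths_sumCongr, cycleLengths_finRotate, hτ', hs, Multiset.singleton_add])
    exact permCongr _ α e _ (sumCongr _ n τ' (ih _ τ' hτ'))

section Centralizer

/-- The order of the centralizer of a permutation with cycle lengths `s`, usually denoted `z_s`. -/
def centralizerOrder (s : Multiset ℕ) : ℕ :=
  s.prod * ∏ l ∈ s.toFinset, (s.count l).factorial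

theorem centralizerOrder_eq_of_subset {s : Multiset ℕ} {t : Finset ℕ} (h : s.toFinset ⊆ t) :
    centralizerOrder s = s.prod * ∏ l ∈ t, (s.count l).factorial := by
  rw [centralizerOrder, Finset.prod_subset h]
  intro l _ hl
  rw [Multiset.count_eq_zero_of_notMem (by simpa using hl), Nat.factorial_zero]

theorem centralizerOrder_add_replicate_one {s : Multiset ℕ} (hs : 1 ∉ s) (m : ℕ) :
    centralizerOrder (s + Multiset.replicate m 1) =
      m.factorial * s.prod * ∏ l ∈ s.toFinset, (s.count l).factorial := by
  have hsub : (s + Multiset.replicate m 1).toFinset ⊆ insert 1 s.toFinset := by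
    intro l
    simp only [Multiset.mem_toFinset, Multiset.mem_add, Multiset.mem_replicate, Finset.mem_insert]
    tauto
  have hcount : ∀ l ∈ s.toFinset, (s + Multiset.replicate m 1).count l = s.count l := by
    intro l hl
    have : 1 ≠ l := by rintro rfl; exact hs (Multiset.mem_toFinset.1 hl)
    simp [Multiset.count_replicate, this]
  rw [centralizerOrder_eq_of_subset hsub, Finset.prod_insert (by simpa using hs),
    Finset.prod_congr rfl fun l hl => by rw [hcount l hl]]
  rw [Multiset.prod_add, Multiset.prod_replicate, one_pow, mul_one, Multiset.count_add,
    Multiset.count_eq_zero_of_notMem hs, Multiset.count_replicate_self, zero_add]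
  ring

variable {α : Type*} [Fintype α] [DecidableEq α]

theorem centralizerOrder_cycleLengths (σ : Perm α) :
    centralizerOrder (cycleLengths σ) = Nat.card (Subgroup.centralizer {σ}) := by
  have h1 : 1 ∉ σ.cycleType := fun h => (Perm.one_lt_of_mem_cycleType h).false
  rw [cycleLengths_eq_cycleType_add, centralizerOrder_add_replicate_one h1,
    Perm.nat_card_centralizer]

theorem card_cycleLengths_eq_mul_centralizerOrder (σ : Perm α) :
    (Finset.univ.filter fun τ : Perm α => cycleLengths τ = cycleLengths σ).card *
      centralizerOrder (cycleLengths σ) = (Fintype.card α).factorial := by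
  rw [← Perm.card_isConj_mul_eq σ, ← Perm.nat_card_centralizer, centralizerOrder_cycleLengths]
  congr 1
  exact (Nat.subtype_card _ fun τ => by
    rw [Finset.mem_filter_univ, cycleLengths_eq_iff_isConj, isConj_comm, Set.mem_ofPred]).symm

theorem sum_perm_eq_sum_partition {n : ℕ} (hα : Fintype.card α = n) (f : Multiset ℕ → ℕ) :
    ∑ σ : Perm α, f (cycleLengths σ) =
      ∑ p : n.Partition, n.factorial / centralizerOrder p.parts * f p.parts := by
  subst hα
  rw [← Finset.sum_fiberwise (g := fun σ : Perm α => σ.partition)]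
  refine Finset.sum_congr rfl fun p _ => ?_
  obtain ⟨τ, hτ⟩ := exists_cycleLengths_eq p.parts fun _ => p.parts_pos
  let e : Fin p.parts.sum ≃ α := Fintype.equivOfCardEq (by rw [Fintype.card_fin, p.parts_sum])
  let σ := e.permCongr τ
  have hσ : cycleLengths σ = p.parts := (cycleLengths_permCongr e τ).trans hτ
  have hpos : 0 < centralizerOrder (cycleLengths σ) :=
    centralizerOrder_cycleLengths σ ▸ Nat.card_pos
  have hclass := card_cycleLengths_eq_mul_centralizerOrder σ
  have hmem : ∀ τ : Perm α, τ.partition = p ↔ cycleLengths τ = p.parts := fun τ =>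
    Nat.Partition.ext_iff
  rw [hσ] at hpos hclass
  simp only [hmem]
  rw [Finset.sum_congr rfl fun τ hτ => by rw [(Finset.mem_filter.1 hτ).2], Finset.sum_const,
    smul_eq_mul, ← hclass, Nat.mul_div_cancel _ hpos]

theorem card_intertwiners (σ τ : Perm α) :
    Nat.card {π : Perm α // σ * π = π * τ} =
      if cycleLengths σ = cycleLengths τ then centralizerOrder (cycleLengths σ) else 0 := by
  split_ifs with h
  · obtain ⟨c, rfl⟩ := isConj_iff.1 (cycleLengths_eq_iff_isConj.1 h)
    rw [centralizerOrder_cycleLengths]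
    refine Nat.card_congr ((Equiv.mulRight c).subtypeEquiv fun π => ?_)
    rw [Subgroup.mem_centralizer_singleton_iff, Equiv.coe_mulRight, ← mul_assoc, ← mul_left_inj c,
      ← mul_assoc]
    simp [mul_assoc, eq_comm]
  · rw [Nat.card_eq_zero]
    refine .inl ⟨fun π => h (cycleLengths_eq_iff_isConj.2 (isConj_comm.1 ?_))⟩
    exact isConj_iff.2 ⟨π.1, by rw [← π.2, mul_inv_cancel_right]⟩

end Centralizer

/-! ### Half-arcs -/

section LiftPairs

/-- The pairs of permutations of `α × ι` that lift a common permutation of `α`. The common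
permutation is recorded because it is not determined by the lifts when `ι` is empty. -/
def liftPairs (α ι : Type*) : Subgroup (Perm α × Perm (α × ι) × Perm (α × ι)) where
  carrier := {γ | ∀ x, (γ.2.1 x).1 = γ.1 x.1 ∧ (γ.2.2 x).1 = γ.1 x.1}
  one_mem' _ := ⟨rfl, rfl⟩
  mul_mem' {γ γ'} h h' x := by simp [(h _).1, (h _).2, (h' _).1, (h' _).2]
  inv_mem' {γ} h x := by
    constructor <;> refine (Perm.inv_eq_iff_eq.2 ?_).symm
    · simp [← (h _).1]
    · simp [← (h _).2]

/-- A pair of lifts acts on the bijections `π` from outgoing to incoming half-arcs by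
`π ↦ g * π * h⁻¹`. -/
instance liftPairs.mulAction (α ι : Type*) : MulAction (liftPairs α ι) (Perm (α × ι)) where
  smul γ π := γ.1.2.1 * π * γ.1.2.2⁻¹
  one_smul π := by
    change 1 * π * 1⁻¹ = π
    simp
  mul_smul γ γ' π := by
    change γ.1.2.1 * γ'.1.2.1 * π * (γ.1.2.2 * γ'.1.2.2)⁻¹ =
      γ.1.2.1 * (γ'.1.2.1 * π * γ'.1.2.2⁻¹) * γ.1.2.2⁻¹
    group

variable {α ι : Type*}

theorem liftPairs.smul_def (γ : liftPairs α ι) (π : Perm (α × ι)) :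
    γ • π = γ.1.2.1 * π * γ.1.2.2⁻¹ := rfl

theorem exists_prodShear_eq {σ : Perm α} {g : Perm (α × ι)} (h : ∀ x, (g x).1 = σ x.1) :
    ∃ ε : α → Perm ι, Equiv.prodShear σ ε = g := by
  have hg : ∀ a i, g (a, i) = (σ a, (g (a, i)).2) := fun a i => Prod.ext (h (a, i)) rfl
  have hinv : ∀ a i, g.symm (σ a, i) = (a, (g.symm (σ a, i)).2) := fun a i =>
    Prod.ext (σ.injective ((h _).symm.trans (by rw [g.apply_symm_apply]))) rfl
  refine ⟨fun a => ⟨fun i => (g (a, i)).2, fun i => (g.symm (σ a, i)).2, fun i => ?_, fun i => ?_⟩,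
    Equiv.ext fun x => (hg x.1 x.2).symm⟩
  · dsimp only
    rw [← hg, g.symm_apply_apply]
  · dsimp only
    rw [← hinv, g.apply_symm_apply]

theorem prodShear_right_injective (σ : Perm α) :
    Function.Injective (Equiv.prodShear σ : (α → Perm ι) → Perm (α × ι)) := by
  intro ε δ h
  ext a i
  exact congrArg Prod.snd (Equiv.congr_fun h (a, i))

/-- A pair of lifts of `σ` amounts to two independent families of permutations of the fibers. -/
noncomputable def liftPairsEquiv (α ι : Type*) :
    Perm α × (α → Perm ι) × (α → Perm ι) ≃ liftPairs α ι :=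
  Equiv.ofBijective
    (fun t => ⟨(t.1, Equiv.prodShear t.1 t.2.1, Equiv.prodShear t.1 t.2.2),
      fun _ => ⟨rfl, rfl⟩⟩) <| by
    constructor
    · rintro ⟨σ, ε, δ⟩ ⟨σ', ε', δ'⟩ h
      obtain ⟨hσ, h⟩ := Prod.mk.inj (congrArg Subtype.val h)
      obtain ⟨hε, hδ⟩ := Prod.mk.inj h
      obtain rfl : σ = σ' := hσ
      obtain rfl : ε = ε' := prodShear_right_injective σ hε
      obtain rfl : δ = δ' := prodShear_right_injective σ hδ
      rfl
    · rintro ⟨⟨σ, g, h⟩, hγ⟩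
      obtain ⟨ε, rfl⟩ := exists_prodShear_eq (σ := σ) fun x => (hγ x).1
      obtain ⟨δ, rfl⟩ := exists_prodShear_eq (σ := σ) fun x => (hγ x).2
      exact ⟨(σ, ε, δ), rfl⟩

end LiftPairs

theorem exists_equiv_comp_eq_of_map_univ_eq {α β γ : Type*} [Fintype α] [Fintype β]
    {f : α → γ} {g : β → γ}
    (h : (Finset.univ : Finset α).val.map f = (Finset.univ : Finset β).val.map g) :
    ∃ e : α ≃ β, g ∘ e = f := by
  classical
  have hfiber : ∀ c, Nonempty ({x // f x = c} ≃ {y // g y = c}) := by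
    intro c
    refine ⟨Fintype.equivOfCardEq ?_⟩
    have hcount := congrArg (Multiset.count c) h
    simpa only [Multiset.count_map, eq_comm (a := c), Fintype.card_subtype, Finset.card_def,
      Finset.filter_val] using hcount
  let φ c := (hfiber c).some
  exact ⟨(Equiv.sigmaFiberEquiv f).symm.trans
    ((Equiv.sigmaCongrRight φ).trans (Equiv.sigmaFiberEquiv g)),
    funext fun x => (φ (f x) ⟨x, rfl⟩).2⟩

namespace MultiDigraph

variable {α ι : Type*} [Fintype α] [Fintype ι]

/-- The digraph on `α` obtained from half-arcs: every node has one outgoing and one incoming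
half-arc for every element of `ι`, and `π` joins every outgoing half-arc to an incoming one. -/
def ofPerm (π : Perm (α × ι)) : MultiDigraph α :=
  ⟨Finset.univ.val.map fun x => (x.1, (π x).1)⟩

theorem map_fst_arcs_ofPerm (π : Perm (α × ι)) :
    (ofPerm π).arcs.map Prod.fst = (Finset.univ : Finset (α × ι)).val.map Prod.fst := by
  rw [ofPerm, Multiset.map_map, Function.comp_def]

theorem map_snd_arcs_ofPerm (π : Perm (α × ι)) :
    (ofPerm π).arcs.map Prod.snd = (Finset.univ : Finset (α × ι)).val.map Prod.fst := by
  rw [ofPerm, Multiset.map_map]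
  conv_rhs => rw [← Multiset.map_univ_val_equiv π, Multiset.map_map]
  rfl

theorem isomorphic_ofPerm_iff (π π' : Perm (α × ι)) :
    (ofPerm π).Isomorphic (ofPerm π') ↔ π' ∈ MulAction.orbit (liftPairs α ι) π := by
  constructor
  · rintro ⟨σ, h⟩
    have harcs := congrArg arcs h
    rw [relabel, ofPerm, ofPerm, Multiset.map_map] at harcs
    obtain ⟨k, hk⟩ := exists_equiv_comp_eq_of_map_univ_eq harcs
    have htail : ∀ x, (k x).1 = σ x.1 := fun x => congrArg Prod.fst (congrFun hk x)
    have hhead : ∀ x, (π' (k x)).1 = σ (π x).1 := fun x => congrArg Prod.snd (congrFun hk x)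
    refine ⟨⟨(σ, π' * k * π⁻¹, k), fun x => ⟨?_, htail x⟩⟩, ?_⟩
    · simpa using hhead (π⁻¹ x)
    · change π' * k * π⁻¹ * π * k⁻¹ = π'
      group
  · rintro ⟨⟨⟨σ, g, k⟩, hγ⟩, rfl⟩
    refine ⟨σ, ?_⟩
    ext1
    rw [relabel, ofPerm, ofPerm, Multiset.map_map]
    conv_rhs => rw [← Multiset.map_univ_val_equiv k, Multiset.map_map]
    refine Multiset.map_congr rfl fun x _ => Prod.ext (hγ x).2.symm ?_
    simpa [liftPairs.smul_def] using (hγ (π x)).1.symm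

variable [DecidableEq α]

theorem isRegular_card_iff {D : MultiDigraph α} :
    D.IsRegular (Fintype.card ι) ↔
      D.arcs.map Prod.fst = (Finset.univ : Finset (α × ι)).val.map Prod.fst ∧
      D.arcs.map Prod.snd = (Finset.univ : Finset (α × ι)).val.map Prod.fst := by
  have hcount : ∀ v, ((Finset.univ : Finset (α × ι)).val.map Prod.fst).count v =
      Fintype.card ι := by
    intro v
    have hfiber : Finset.univ.filter (fun x : α × ι => v = x.1) = {v} ×ˢ Finset.univ := by
      ext x
      simp only [Finset.mem_filter_univ, Finset.mem_product, Finset.mem_singleton,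
        Finset.mem_univ, and_true, eq_comm]
    rw [Multiset.count_map, ← Finset.filter_val, ← Finset.card_def, hfiber, Finset.card_product,
      Finset.card_singleton, one_mul, Finset.card_univ]
  simp only [Multiset.ext, hcount, Multiset.count_map, ← Multiset.countP_eq_card_filter,
    eq_comm (b := Prod.fst _), eq_comm (b := Prod.snd _)]
  exact forall_and

theorem isRegular_ofPerm (π : Perm (α × ι)) : (ofPerm π).IsRegular (Fintype.card ι) :=
  isRegular_card_iff.2 ⟨map_fst_arcs_ofPerm π, map_snd_arcs_ofPerm π⟩

theorem IsRegular.exists_ofPerm_eq {D : MultiDigraph α} (hD : D.IsRegular (Fintype.card ι)) :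
    ∃ π : Perm (α × ι), ofPerm π = D := by
  obtain ⟨hfst, hsnd⟩ := isRegular_card_iff.1 hD
  rw [← Multiset.map_univ_comp_coe] at hfst hsnd
  obtain ⟨e, he⟩ := exists_equiv_comp_eq_of_map_univ_eq hfst
  obtain ⟨f, hf⟩ := exists_equiv_comp_eq_of_map_univ_eq hsnd
  refine ⟨e.symm.trans f, ?_⟩
  ext1
  rw [ofPerm, ← Multiset.map_univ_val_equiv e, Multiset.map_map]
  conv_rhs => rw [← Multiset.map_univ_coe D.arcs]
  refine Multiset.map_congr rfl fun a _ => Prod.ext (congrFun he a) ?_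
  simpa using congrFun hf a

end MultiDigraph

section Burnside

variable (ι : Type*) [Fintype ι] (n : ℕ)

theorem card_orbits_liftPairs :
    Nat.card (MulAction.orbitRel.Quotient (liftPairs (Fin n) ι) (Perm (Fin n × ι))) =
      numUnlabeled (Fintype.card ι) n := by
  let toDigraph (π : Perm (Fin n × ι)) : LabeledRegularDigraph (Fintype.card ι) n :=
    ⟨.ofPerm π, MultiDigraph.isRegular_ofPerm π⟩
  have hiso : ∀ π π' : Perm (Fin n × ι), MulAction.orbitRel (liftPairs (Fin n) ι) _ π π' ↔
      toDigraph π ≈ toDigraph π' := fun π π' =>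
    ⟨fun h => ((MultiDigraph.isomorphic_ofPerm_iff π' π).2 h).symm,
      fun h => (MultiDigraph.isomorphic_ofPerm_iff π' π).1 h.symm⟩
  refine Nat.card_congr (Equiv.ofBijective
    (Quotient.map toDigraph fun π π' h => (hiso π π').1 h) ⟨?_, ?_⟩)
  · rintro ⟨π⟩ ⟨π'⟩ h
    exact Quotient.sound ((hiso π π').2 (Quotient.exact h))
  · rintro ⟨D, hD⟩
    obtain ⟨π, rfl⟩ := hD.exists_ofPerm_eq
    exact ⟨Quotient.mk _ π, rfl⟩

theorem card_liftPairs : Nat.card (liftPairs (Fin n) ι) =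
    n.factorial * ((Fintype.card ι).factorial ^ n * (Fintype.card ι).factorial ^ n) := by
  classical
  rw [← Nat.card_congr (liftPairsEquiv (Fin n) ι), Nat.card_eq_fintype_card, Fintype.card_prod,
    Fintype.card_prod, Fintype.card_fun, Fintype.card_perm, Fintype.card_perm, Fintype.card_fin]

theorem numUnlabeled_card_mul [DecidableEq ι] :
    numUnlabeled (Fintype.card ι) n *
        (n.factorial * ((Fintype.card ι).factorial ^ n * (Fintype.card ι).factorial ^ n)) =
      ∑ σ : Perm (Fin n), ∑ ε : Fin n → Perm ι, ∑ δ : Fin n → Perm ι,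
        if cycleLengths (Equiv.prodShear σ ε) = cycleLengths (Equiv.prodShear σ δ) then
          centralizerOrder (cycleLengths (Equiv.prodShear σ ε)) else 0 := by
  classical
  have : Fintype (liftPairs (Fin n) ι) := Fintype.ofEquiv _ (liftPairsEquiv (Fin n) ι)
  rw [← card_orbits_liftPairs, ← card_liftPairs, Nat.card_eq_fintype_card, Nat.card_eq_fintype_card,
    ← MulAction.sum_card_fixedBy_eq_card_orbits_mul_card_group,
    ← (liftPairsEquiv (Fin n) ι).sum_comp]
  simp only [Fintype.sum_prod_type]
  refine Finset.sum_congr rfl fun σ _ => Finset.sum_congr rfl fun ε _ =>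
    Finset.sum_congr rfl fun δ _ => ?_
  rw [← card_intertwiners, ← Nat.card_eq_fintype_card]
  refine Nat.card_congr (Equiv.subtypeEquivRight fun π => ?_)
  rw [MulAction.mem_fixedBy, liftPairs.smul_def, mul_inv_eq_iff_eq_mul]
  rfl

end Burnside

instance finite_unlabeledRegularDigraph (k n : ℕ) : Finite (UnlabeledRegularDigraph k n) := by
  refine Finite.of_surjective (fun π : Perm (Fin n × Fin k) =>
    (⟦⟨.ofPerm π, by simpa using MultiDigraph.isRegular_ofPerm π⟩⟧ :
      UnlabeledRegularDigraph k n)) ?_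
  rintro ⟨D, hD⟩
  obtain ⟨π, rfl⟩ := MultiDigraph.IsRegular.exists_ofPerm_eq (ι := Fin k) (by simpa using hD)
  exact ⟨π, rfl⟩

/-! ### Lifts of permutations -/

section Lifts

variable {α β ι κ : Type*}

theorem prodShear_permCongr (e : α ≃ β) (σ : Perm α) (ε : β → Perm ι) :
    Equiv.prodShear (e.permCongr σ) ε =
      (e.prodCongr (Equiv.refl ι)).permCongr (Equiv.prodShear σ (ε ∘ e)) := by
  ext x <;> simp

theorem prodShear_sumCongr (σ : Perm α) (τ : Perm β) (ε : α → Perm ι) (δ : β → Perm ι) :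
    Equiv.prodShear (Perm.sumCongr σ τ) (Sum.elim ε δ) =
      (Equiv.sumProdDistrib α β ι).symm.permCongr
        (Perm.sumCongr (Equiv.prodShear σ ε) (Equiv.prodShear τ δ)) := by
  ext ⟨x | x, i⟩ <;> simp

/-- The lift of a cyclic rotation that permutes the fibers only over the last point. -/
def rotationLift (n : ℕ) (τ : Perm ι) : Perm (Fin (n + 1) × ι) :=
  Equiv.prodShear (finRotate (n + 1)) (Fin.snoc (α := fun _ => Perm ι) 1 τ)

theorem rotationLift_castSucc (n : ℕ) (τ : Perm ι) (a : Fin n) (i : ι) :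
    rotationLift n τ (a.castSucc, i) = (a.succ, i) := by
  simp [rotationLift]

theorem rotationLift_last (n : ℕ) (τ : Perm ι) (i : ι) :
    rotationLift n τ (Fin.last n, i) = (0, τ i) := by
  simp [rotationLift]

variable [Fintype α] [DecidableEq α] [Fintype β] [DecidableEq β] [Fintype ι] [DecidableEq ι]

theorem cycleLengths_prodShear_permCongr (e : α ≃ β) (σ : Perm α) (ε : β → Perm ι) :
    cycleLengths (Equiv.prodShear (e.permCongr σ) ε) =
      cycleLengths (Equiv.prodShear σ (ε ∘ e)) := by
  rw [prodShear_permCongr, cycleLengths_permCongr]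

theorem cycleLengths_prodShear_sumCongr (σ : Perm α) (τ : Perm β) (ε : α → Perm ι)
    (δ : β → Perm ι) :
    cycleLengths (Equiv.prodShear (Perm.sumCongr σ τ) (Sum.elim ε δ)) =
      cycleLengths (Equiv.prodShear σ ε) + cycleLengths (Equiv.prodShear τ δ) := by
  rw [prodShear_sumCongr, cycleLengths_permCongr, cycleLengths_sumCongr]

theorem cycleLengths_prodShear_gauge (σ : Perm α) (ε s : α → Perm ι) :
    cycleLengths (Equiv.prodShear σ fun a => s (σ a) * ε a * (s a)⁻¹) =
      cycleLengths (Equiv.prodShear σ ε) := by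
  rw [← cycleLengths_permCongr (Equiv.prodShear (Equiv.refl α) s) (Equiv.prodShear σ ε)]
  exact congrArg cycleLengths (Equiv.ext fun _ => rfl)

theorem cycleLengths_rotationLift_finRotate (n m : ℕ) :
    cycleLengths (rotationLift n (finRotate (m + 1))) = {(n + 1) * (m + 1)} := by
  let N := (n + 1) * m + n
  have hN : (m + 1) * (n + 1) = N + 1 := by ring
  let e : Fin (n + 1) × Fin (m + 1) ≃ Fin (N + 1) :=
    (Equiv.prodComm _ _).trans (finProdFinEquiv.trans (finCongr hN))
  have he : ∀ a j, (e (a, j) : ℕ) = a + (n + 1) * j := fun _ _ => rfl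
  have hnext : ∀ x y, (e y : ℕ) = e x + 1 → e y = finRotate (N + 1) (e x) := fun x y h => by
    have hx : e x ≠ Fin.last N := fun hx => (e y).2.ne (by rw [h, hx, Fin.val_last])
    rw [Fin.ext_iff, coe_finRotate_of_ne_last hx, h]
  have hrot : e.permCongr (rotationLift n (finRotate (m + 1))) = finRotate (N + 1) := by
    refine Equiv.ext (e.forall_congr_right.1 ?_)
    rintro ⟨a, j⟩
    rw [Equiv.permCongr_apply, e.symm_apply_apply]
    cases a using Fin.lastCases with
    | cast a =>
      refine hnext _ _ ?_
      rw [rotationLift_castSucc, he, he, Fin.val_succ, Fin.val_castSucc, add_right_comm]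
    | last =>
      rw [rotationLift_last]
      cases j using Fin.lastCases with
      | cast j =>
        refine hnext _ _ ?_
        rw [finRotate_apply, Fin.coeSucc_eq_succ, he, he, Fin.val_zero, Fin.val_last,
          Fin.val_succ, Fin.val_castSucc]
        ring
      | last =>
        have hlast : e (Fin.last n, Fin.last m) = Fin.last N := Fin.ext (add_comm _ _)
        rw [hlast, finRotate_last, finRotate_last]
        rfl
  rw [← cycleLengths_permCongr e, hrot, cycleLengths_finRotate, ← hN, mul_comm]

theorem cycleLengths_rotationLift (n : ℕ) (τ : Perm ι) :
    cycleLengths (rotationLift n τ) = (cycleLengths τ).map ((n + 1) * ·) := by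
  refine perm_induction_on_cycles (motive := fun ι _ _ τ =>
    cycleLengths (rotationLift n τ) = (cycleLengths τ).map ((n + 1) * ·)) ?_ ?_ ?_ ι τ
  · intro ι κ _ _ _ _ e τ h
    have : rotationLift n (e.permCongr τ) =
        ((Equiv.refl (Fin (n + 1))).prodCongr e).permCongr (rotationLift n τ) := by
      ext ⟨a, i⟩ : 1
      cases a using Fin.lastCases <;> simp [rotationLift_castSucc, rotationLift_last]
    rw [this, cycleLengths_permCongr, cycleLengths_permCongr, h]
  · intro ι _ _ _ τ
    rw [cycleLengths_of_isEmpty, cycleLengths_of_isEmpty, Multiset.map_zero]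
  · intro ι _ _ m τ h
    have : rotationLift n (Perm.sumCongr (finRotate (m + 1)) τ) =
        (Equiv.prodSumDistrib (Fin (n + 1)) (Fin (m + 1)) ι).symm.permCongr
          (Perm.sumCongr (rotationLift n (finRotate (m + 1))) (rotationLift n τ)) := by
      ext ⟨a, i | i⟩ : 1 <;> cases a using Fin.lastCases <;>
        simp [rotationLift_castSucc, rotationLift_last]
    rw [this, cycleLengths_permCongr, cycleLengths_sumCongr, cycleLengths_sumCongr, h,
      cycleLengths_rotationLift_finRotate, cycleLengths_finRotate, Multiset.map_add,
      Multiset.map_singleton]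

/-- Gauging by partial products makes the first `n` fiber permutations trivial and leaves the total
holonomy over the last point. -/
theorem cycleLengths_prodShear_finRotate {n : ℕ} (δ : Fin n → Perm ι) (ρ : Perm ι) :
    cycleLengths (Equiv.prodShear (finRotate (n + 1)) (Fin.snoc (α := fun _ => Perm ι) δ ρ)) =
      (cycleLengths (ρ * (Fin.partialProd (fun a => (δ a)⁻¹) (Fin.last n))⁻¹)).map
        ((n + 1) * ·) := by
  rw [← cycleLengths_rotationLift,
    ← cycleLengths_prodShear_gauge _ _ (Fin.partialProd fun a => (δ a)⁻¹), rotationLift]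
  congr 2
  ext a : 1
  cases a using Fin.lastCases <;> simp [Fin.partialProd_succ]

theorem sum_cycleLengths_prodShear_finRotate (n : ℕ) (f : Multiset ℕ → ℕ) :
    ∑ ε : Fin (n + 1) → Perm ι, f (cycleLengths (Equiv.prodShear (finRotate (n + 1)) ε)) =
      (Fintype.card ι).factorial ^ n *
        ∑ τ : Perm ι, f ((cycleLengths τ).map ((n + 1) * ·)) := by
  rw [← (Fin.snocEquiv fun _ => Perm ι).sum_comp, Fintype.sum_prod_type_right]
  have hδ : ∀ δ : Fin n → Perm ι,
      ∑ ρ, f (cycleLengths (Equiv.prodShear (finRotate (n + 1)) (Fin.snocEquiv _ (ρ, δ)))) =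
        ∑ τ : Perm ι, f ((cycleLengths τ).map ((n + 1) * ·)) := fun δ => by
    rw [← Equiv.sum_comp (Equiv.mulRight (Fin.partialProd (fun a => (δ a)⁻¹) (Fin.last n))⁻¹)
      fun τ : Perm ι => f ((cycleLengths τ).map ((n + 1) * ·))]
    exact Finset.sum_congr rfl fun ρ _ => congrArg f (cycleLengths_prodShear_finRotate δ ρ)
  rw [Finset.sum_congr rfl fun δ _ => hδ δ, Finset.sum_const, smul_eq_mul, Finset.card_univ,
    Fintype.card_fun, Fintype.card_perm, Fintype.card_fin]

end Lifts

section DoubleCovers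

/-- The cycle lengths of the double covers of a permutation with cycle lengths `s`: over every
cycle of length `l` lie either two cycles of length `l` or one of length `2 * l`. -/
def doubleCoverCycleLengths (s : Multiset ℕ) : Multiset (Multiset ℕ) :=
  s.antidiagonal.map fun p => p.1 + p.1 + p.2.map (2 * ·)

theorem sum_map_doubleCoverCycleLengths_cons (a : ℕ) (s : Multiset ℕ) (f : Multiset ℕ → ℕ) :
    ((doubleCoverCycleLengths (a ::ₘ s)).map f).sum =
      ((doubleCoverCycleLengths s).map fun c => f ({a, a} + c) + f ({2 * a} + c)).sum := by
  rw [Multiset.sum_map_add, add_comm]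
  simp only [doubleCoverCycleLengths, Multiset.antidiagonal_cons, Multiset.map_add,
    Multiset.map_map, Multiset.sum_add, Function.comp_def]
  congr 3 <;> ext p <;> simp

theorem sum_cycleLengths_fin_two (f : Multiset ℕ → ℕ) :
    ∑ τ : Perm (Fin 2), f (cycleLengths τ) = f {1, 1} + f {2} := by
  have huniv : (Finset.univ : Finset (Perm (Fin 2))) = {1, finRotate 2} := by decide
  have hone : cycleLengths (1 : Perm (Fin 2)) = {1, 1} := by
    rw [cycleLengths_eq_cycleType_add, Perm.cycleType_one]
    rfl
  rw [huniv, Finset.sum_pair (by decide), hone, cycleLengths_finRotate]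

theorem sum_cycleLengths_prodShear_fin_two {α : Type*} [Fintype α] [DecidableEq α] (σ : Perm α)
    (f : Multiset ℕ → ℕ) :
    ∑ ε : α → Perm (Fin 2), f (cycleLengths (Equiv.prodShear σ ε)) =
      ((cycleLengths σ).map fun l => 2 ^ (l - 1)).prod *
        ((doubleCoverCycleLengths (cycleLengths σ)).map f).sum := by
  revert f
  refine perm_induction_on_cycles (motive := fun α _ _ σ => ∀ f : Multiset ℕ → ℕ,
    ∑ ε : α → Perm (Fin 2), f (cycleLengths (Equiv.prodShear σ ε)) =
      ((cycleLengths σ).map fun l => 2 ^ (l - 1)).prod *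
        ((doubleCoverCycleLengths (cycleLengths σ)).map f).sum) ?_ ?_ ?_ α σ
  · intro α β _ _ _ _ e σ h f
    rw [cycleLengths_permCongr, ← h, ← (Equiv.arrowCongr e (Equiv.refl (Perm (Fin 2)))).sum_comp]
    refine Finset.sum_congr rfl fun ε _ => ?_
    rw [cycleLengths_prodShear_permCongr]
    congr 3
    ext a : 1
    simp
  · intro α _ _ _ σ f
    simp [cycleLengths_of_isEmpty, doubleCoverCycleLengths]
  · intro α _ _ n σ h f
    rw [← (Equiv.sumArrowEquivProdArrow _ _ _).symm.sum_comp, Fintype.sum_prod_type,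
      cycleLengths_sumCongr, cycleLengths_finRotate, Multiset.singleton_add, Multiset.map_cons,
      Multiset.prod_cons, sum_map_doubleCoverCycleLengths_cons, mul_assoc, ← h]
    have hε : ∀ ε : Fin (n + 1) → Perm (Fin 2), ∀ δ : α → Perm (Fin 2),
        cycleLengths (Equiv.prodShear (Perm.sumCongr (finRotate (n + 1)) σ)
          ((Equiv.sumArrowEquivProdArrow _ _ _).symm (ε, δ))) =
        cycleLengths (Equiv.prodShear (finRotate (n + 1)) ε) +
          cycleLengths (Equiv.prodShear σ δ) :=
      cycleLengths_prodShear_sumCongr _ _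
    simp only [hε]
    rw [Finset.sum_comm, Finset.mul_sum]
    refine Finset.sum_congr rfl fun δ _ => ?_
    rw [sum_cycleLengths_prodShear_finRotate n fun c => f (c + cycleLengths (Equiv.prodShear σ δ)),
      sum_cycleLengths_fin_two fun c =>
        f (c.map ((n + 1) * ·) + cycleLengths (Equiv.prodShear σ δ))]
    simp [mul_comm 2]

/-- The total number of fixed points of the pairs of double covers of a permutation with cycle
lengths `s`. -/
def doubleCoverFixedPoints (s : Multiset ℕ) : ℕ :=
  (s.map fun l => 2 ^ (l - 1)).prod ^ 2 *
    ∑ c ∈ (doubleCoverCycleLengths s).toFinset,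
      (doubleCoverCycleLengths s).count c ^ 2 * centralizerOrder c

theorem sum_sum_ite_eq_doubleCoverFixedPoints {α : Type*} [Fintype α] [DecidableEq α]
    (σ : Perm α) :
    ∑ ε : α → Perm (Fin 2), ∑ δ : α → Perm (Fin 2),
      (if cycleLengths (Equiv.prodShear σ ε) = cycleLengths (Equiv.prodShear σ δ) then
        centralizerOrder (cycleLengths (Equiv.prodShear σ ε)) else 0) =
      doubleCoverFixedPoints (cycleLengths σ) := by
  let m := doubleCoverCycleLengths (cycleLengths σ)
  let P := ((cycleLengths σ).map fun l => 2 ^ (l - 1)).prod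
  have hite : ∀ c, (m.map fun d => if c = d then centralizerOrder c else 0).sum =
      m.count c * centralizerOrder c := fun c => by
    simp +contextual [Finset.sum_multiset_map_count]
  calc
    _ = ∑ ε : α → Perm (Fin 2), P * (m.count (cycleLengths (Equiv.prodShear σ ε)) *
          centralizerOrder (cycleLengths (Equiv.prodShear σ ε))) :=
      Finset.sum_congr rfl fun ε _ => by
        rw [sum_cycleLengths_prodShear_fin_two σ fun d =>
          if cycleLengths (Equiv.prodShear σ ε) = d then _ else 0, hite]
    _ = P * (m.map fun c => P * (m.count c * centralizerOrder c)).sum :=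
      sum_cycleLengths_prodShear_fin_two σ fun c => P * (m.count c * centralizerOrder c)
    _ = doubleCoverFixedPoints (cycleLengths σ) := by
      rw [Multiset.sum_map_mul_left, Finset.sum_multiset_map_count, ← mul_assoc, ← sq,
        doubleCoverFixedPoints]
      simp only [sq, smul_eq_mul, mul_assoc, P, m]

end DoubleCovers

theorem numUnlabeled_two_mul (n : ℕ) :
    numUnlabeled 2 n * (n.factorial * 4 ^ n) =
      ∑ p : n.Partition,
        n.factorial / centralizerOrder p.parts * doubleCoverFixedPoints p.parts := by
  have h := numUnlabeled_card_mul (Fin 2) n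
  simp only [sum_sum_ite_eq_doubleCoverFixedPoints, Fintype.card_fin, Nat.factorial_two] at h
  rwa [sum_perm_eq_sum_partition (Fintype.card_fin n), ← mul_pow] at h

/-! ### Components -/

namespace MultiDigraph

variable {V W ι : Type*} {D : MultiDigraph V}

theorem underlyingGraph_adj {u v : V} :
    D.underlyingGraph.Adj u v ↔ u ≠ v ∧ ((u, v) ∈ D.arcs ∨ (v, u) ∈ D.arcs) :=
  SimpleGraph.fromRel_adj _ u v

theorem numComponents_eq_one_iff : D.numComponents = 1 ↔ D.underlyingGraph.Connected := by
  rw [numComponents, Nat.card_eq_one_iff_unique, SimpleGraph.connected_iff]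
  constructor
  · rintro ⟨h, ⟨C⟩⟩
    exact ⟨fun u v => SimpleGraph.ConnectedComponent.exact (Subsingleton.elim _ _), ⟨C.out⟩⟩
  · rintro ⟨h, ⟨v⟩⟩
    exact ⟨h.subsingleton_connectedComponent, ⟨D.underlyingGraph.connectedComponentMk v⟩⟩

section Restrict

variable [Fintype V] [DecidableEq V]

/-- The subdigraph induced on the nodes that satisfy `p`. -/
def restrict (D : MultiDigraph V) (p : V → Prop) [DecidablePred p] : MultiDigraph {v // p v} :=
  ofAdjMatrix (D.adjMatrix.submatrix Subtype.val Subtype.val)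

variable {p : V → Prop} [DecidablePred p]

@[simp]
theorem adjMatrix_restrict :
    (D.restrict p).adjMatrix = D.adjMatrix.submatrix Subtype.val Subtype.val :=
  adjMatrix_ofAdjMatrix _

theorem mem_arcs_restrict {u v : {v // p v}} :
    (u, v) ∈ (D.restrict p).arcs ↔ (u.1, v.1) ∈ D.arcs := by
  rw [← adjMatrix_ne_zero, adjMatrix_restrict, Matrix.submatrix_apply, adjMatrix_ne_zero]

theorem underlyingGraph_restrict :
    (D.restrict p).underlyingGraph = D.underlyingGraph.induce {v | p v} := by
  ext u v
  simp only [underlyingGraph_adj, mem_arcs_restrict, SimpleGraph.comap_adj, Ne, Subtype.ext_iff,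
    Function.Embedding.subtype_apply]

theorem restrict_isomorphic_restrict [Fintype W] [DecidableEq W] {E : MultiDigraph W} {e : V ≃ W}
    (he : E.adjMatrix.submatrix e e = D.adjMatrix) {q : W → Prop} [DecidablePred q]
    (hpq : ∀ v, p v ↔ q (e v)) : (D.restrict p).Isomorphic (E.restrict q) := by
  refine isomorphic_iff_adjMatrix.2 ⟨e.subtypeEquiv hpq, ?_⟩
  rw [adjMatrix_restrict, adjMatrix_restrict, ← he]
  rfl

end Restrict

/-- A labeling of the nodes that is constant along the arcs. Such a labeling splits the digraph
into a disjoint union of the subdigraphs induced on its fibers. -/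
def IsLocallyConstant (D : MultiDigraph V) (κ : V → ι) : Prop :=
  ∀ ⦃u v⦄, (u, v) ∈ D.arcs → κ u = κ v

theorem isLocallyConstant_connectedComponentMk (D : MultiDigraph V) :
    D.IsLocallyConstant D.underlyingGraph.connectedComponentMk := by
  intro u v huv
  by_cases h : u = v
  · rw [h]
  · exact SimpleGraph.ConnectedComponent.sound (underlyingGraph_adj.2 ⟨h, .inl huv⟩).reachable

namespace IsLocallyConstant

variable {κ : V → ι}

theorem eq_of_reachable (h : D.IsLocallyConstant κ) {u v : V}
    (huv : D.underlyingGraph.Reachable u v) : κ u = κ v := by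
  obtain ⟨p⟩ := huv
  induction p with
  | nil => rfl
  | cons hadj _ ih =>
    exact ((underlyingGraph_adj.1 hadj).2.elim (@h _ _) fun h' => (h h').symm).trans ih

variable [DecidableEq V]

theorem adjMatrix_eq_zero (h : D.IsLocallyConstant κ) {u v : V} (huv : κ u ≠ κ v) :
    D.adjMatrix u v = 0 :=
  of_not_not fun hne => huv (h (adjMatrix_ne_zero.1 hne))

variable [Fintype V] [DecidableEq ι]

theorem isRegular_iff (h : D.IsLocallyConstant κ) {k : ℕ} :
    D.IsRegular k ↔ ∀ i, (D.restrict (κ · = i)).IsRegular k := by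
  have hrow (i : ι) (v : {v // κ v = i}) :
      ∑ u, (D.restrict (κ · = i)).adjMatrix v u = ∑ u, D.adjMatrix v u := by
    refine Fintype.sum_of_injective _ Subtype.val_injective _ _ (fun u hu => ?_) fun u => by simp
    exact h.adjMatrix_eq_zero fun hκ => hu ⟨⟨u, hκ.symm.trans v.2⟩, rfl⟩
  have hcol (i : ι) (v : {v // κ v = i}) :
      ∑ u, (D.restrict (κ · = i)).adjMatrix u v = ∑ u, D.adjMatrix u v := by
    refine Fintype.sum_of_injective _ Subtype.val_injective _ _ (fun u hu => ?_) fun u => by simp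
    exact h.adjMatrix_eq_zero fun hκ => hu ⟨⟨u, hκ.trans v.2⟩, rfl⟩
  simp only [isRegular_iff_adjMatrix, hrow, hcol]
  exact ⟨fun hD i v => hD v, fun hD v => hD (κ v) ⟨v, rfl⟩⟩

theorem isomorphic [Fintype W] [DecidableEq W] {E : MultiDigraph W} {ι' : Type*} [DecidableEq ι']
    {κ' : W → ι'} (h : D.IsLocallyConstant κ) (h' : E.IsLocallyConstant κ') (ψ : ι ≃ ι')
    (hψ : ∀ i, (D.restrict (κ · = i)).Isomorphic (E.restrict (κ' · = ψ i))) :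
    D.Isomorphic E := by
  simp only [isomorphic_iff_adjMatrix, adjMatrix_restrict, ← Matrix.ext_iff,
    Matrix.submatrix_apply] at hψ ⊢
  choose φ hφ using hψ
  let e : V ≃ W := (Equiv.sigmaFiberEquiv κ).symm.trans
    ((ψ.sigmaCongr φ).trans (Equiv.sigmaFiberEquiv κ'))
  have he : ∀ i (v : {v // κ v = i}), e v.1 = (φ i v).1 := by
    rintro _ ⟨v, rfl⟩
    rfl
  have hκ : ∀ v, κ' (e v) = ψ (κ v) := fun v => (φ (κ v) ⟨v, rfl⟩).2
  refine ⟨e, fun u v => ?_⟩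
  by_cases huv : κ u = κ v
  · rw [he (κ v) ⟨u, huv⟩, he (κ v) ⟨v, rfl⟩]
    exact hφ (κ v) ⟨u, huv⟩ ⟨v, rfl⟩
  · rw [h.adjMatrix_eq_zero huv, h'.adjMatrix_eq_zero]
    rwa [hκ, hκ, ψ.injective.ne_iff]

theorem exists_equiv_connectedComponent (h : D.IsLocallyConstant κ)
    (hc : ∀ i, (D.restrict (κ · = i)).numComponents = 1) :
    ∃ ψ : D.underlyingGraph.ConnectedComponent ≃ ι,
      ∀ v, ψ (D.underlyingGraph.connectedComponentMk v) = κ v := by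
  simp only [numComponents_eq_one_iff, underlyingGraph_restrict] at hc
  refine ⟨Equiv.ofBijective (SimpleGraph.ConnectedComponent.lift κ fun u v p _ =>
    h.eq_of_reachable ⟨p⟩) ⟨?_, fun i => ?_⟩, fun v => rfl⟩
  · refine SimpleGraph.ConnectedComponent.ind₂ fun u v (huv : κ u = κ v) => ?_
    exact SimpleGraph.ConnectedComponent.sound
      (((hc (κ v)).preconnected ⟨u, huv⟩ ⟨v, rfl⟩).map (SimpleGraph.Embedding.induce _).toHom)
  · obtain ⟨⟨v, hv⟩⟩ := (hc i).nonempty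
    exact ⟨D.underlyingGraph.connectedComponentMk v, hv⟩

end IsLocallyConstant

theorem numComponents_restrict_connectedComponent [Fintype V] [DecidableEq V]
    [DecidableEq D.underlyingGraph.ConnectedComponent]
    (C : D.underlyingGraph.ConnectedComponent) :
    (D.restrict (D.underlyingGraph.connectedComponentMk · = C)).numComponents = 1 := by
  rw [numComponents_eq_one_iff, underlyingGraph_restrict]
  exact C.connected_toSimpleGraph

section Sigma

variable [Fintype ι] [DecidableEq ι] {V : ι → Type*} [∀ i, Fintype (V i)] [∀ i, DecidableEq (V i)]

/-- The disjoint union of a family of digraphs. -/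
def sigma (E : ∀ i, MultiDigraph (V i)) : MultiDigraph (Σ i, V i) :=
  ofAdjMatrix (Matrix.blockDiagonal' fun i => (E i).adjMatrix)

theorem isLocallyConstant_sigma (E : ∀ i, MultiDigraph (V i)) :
    (sigma E).IsLocallyConstant Sigma.fst := by
  rintro ⟨i, u⟩ ⟨j, v⟩ huv
  by_contra h
  rw [← adjMatrix_ne_zero, sigma, adjMatrix_ofAdjMatrix] at huv
  exact huv (Matrix.blockDiagonal'_apply_ne (fun i => (E i).adjMatrix) u v h)

theorem isomorphic_restrict_sigma (E : ∀ i, MultiDigraph (V i)) (i : ι) :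
    (E i).Isomorphic ((sigma E).restrict (Sigma.fst · = i)) := by
  refine isomorphic_iff_adjMatrix.2 ⟨(Equiv.sigmaSubtype i).symm, ?_⟩
  ext u v
  rw [adjMatrix_restrict, sigma, adjMatrix_ofAdjMatrix]
  exact Matrix.blockDiagonal'_apply_eq (fun i => (E i).adjMatrix) i u v

end Sigma

end MultiDigraph

/-- Isomorphism classes of `k`-regular digraphs with any number of nodes. -/
abbrev RegularDigraphClass (k : ℕ) : Type := Σ n, UnlabeledRegularDigraph k n

namespace RegularDigraphClass

variable {k : ℕ}

/-- The number of nodes. -/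
abbrev size (q : RegularDigraphClass k) : ℕ := q.1

/-- The number of weakly connected components. -/
noncomputable abbrev numComponents (q : RegularDigraphClass k) : ℕ := q.2.numComponents

variable {V W : Type*} [Fintype V] [DecidableEq V] [Fintype W] [DecidableEq W]
  {D : MultiDigraph V} {E : MultiDigraph W}

/-- The isomorphism class of a digraph. -/
noncomputable def of (D : MultiDigraph V) (hD : D.IsRegular k) : RegularDigraphClass k :=
  ⟨Fintype.card V, ⟦⟨D.relabel (Fintype.equivFin V), hD.of_isomorphic ⟨_, rfl⟩⟩⟧⟩

theorem of_eq_mk_iff {hD : D.IsRegular k} {n : ℕ} {E : LabeledRegularDigraph k n} :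
    of D hD = ⟨n, ⟦E⟧⟩ ↔ D.Isomorphic E.1 := by
  have hrelabel : D.Isomorphic (D.relabel (Fintype.equivFin V)) := ⟨_, rfl⟩
  constructor
  · intro h
    obtain rfl : Fintype.card V = n := congrArg Sigma.fst h
    exact hrelabel.trans (Quotient.exact (eq_of_heq (Sigma.mk.inj h).2))
  · intro h
    obtain rfl : Fintype.card V = n := by
      obtain ⟨e, -⟩ := h
      simpa using Fintype.card_congr e
    exact congrArg (Sigma.mk _) (Quotient.sound (hrelabel.symm.trans h))

theorem of_eq_of_iff {hD : D.IsRegular k} {hE : E.IsRegular k} :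
    of D hD = of E hE ↔ D.Isomorphic E := by
  have hrelabel : E.Isomorphic (E.relabel (Fintype.equivFin W)) := ⟨_, rfl⟩
  exact of_eq_mk_iff.trans ⟨fun h => h.trans hrelabel.symm, fun h => h.trans hrelabel⟩

theorem exists_of_eq (q : RegularDigraphClass k) :
    ∃ (n : ℕ) (D : MultiDigraph (Fin n)) (hD : D.IsRegular k), of D hD = q := by
  obtain ⟨n, ⟨D⟩⟩ := q
  exact ⟨n, D.1, D.2, of_eq_mk_iff.2 (.refl D.1)⟩

theorem size_of (hD : D.IsRegular k) : (of D hD).size = Fintype.card V := rfl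

theorem numComponents_of (hD : D.IsRegular k) : (of D hD).numComponents = D.numComponents :=
  MultiDigraph.Isomorphic.numComponents_eq (MultiDigraph.Isomorphic.symm ⟨_, rfl⟩)

/-- Isomorphism classes of connected `k`-regular digraphs. -/
abbrev Connected (k : ℕ) : Type := {q : RegularDigraphClass k // q.numComponents = 1}

theorem Connected.one_le_size (c : Connected k) : 1 ≤ c.1.size := by
  obtain ⟨q, hq⟩ := c
  obtain ⟨n, D, hD, rfl⟩ := q.exists_of_eq
  rw [numComponents_of, MultiDigraph.numComponents_eq_one_iff] at hq
  exact Fintype.card_pos_iff.2 hq.nonempty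

open Classical in
/-- The class of a weakly connected component of a digraph. -/
noncomputable def component (D : MultiDigraph V) (hD : D.IsRegular k)
    (C : D.underlyingGraph.ConnectedComponent) : Connected k :=
  ⟨of (D.restrict (D.underlyingGraph.connectedComponentMk · = C))
    (D.isLocallyConstant_connectedComponentMk.isRegular_iff.1 hD C), by
    rw [numComponents_of, D.numComponents_restrict_connectedComponent]⟩

open Classical in
/-- The classes of the weakly connected components of a digraph, with multiplicity. -/
noncomputable def componentsOf (D : MultiDigraph V) (hD : D.IsRegular k) :
    Multiset (Connected k) :=
  (Finset.univ : Finset D.underlyingGraph.ConnectedComponent).val.map (component D hD)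

theorem componentsOf_eq {ι : Type*} [Fintype ι] [DecidableEq ι] {hD : D.IsRegular k} {κ : V → ι}
    (h : D.IsLocallyConstant κ) (f : ι → Connected k)
    (hf : ∀ i, (f i).1 = of (D.restrict (κ · = i)) (h.isRegular_iff.1 hD i)) :
    componentsOf D hD = (Finset.univ : Finset ι).val.map f := by
  classical
  obtain ⟨ψ, hψ⟩ := h.exists_equiv_connectedComponent fun i => by
    rw [← numComponents_of (h.isRegular_iff.1 hD i), ← hf i]
    exact (f i).2
  rw [componentsOf, ← Multiset.map_univ_val_equiv ψ, Multiset.map_map]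
  refine Multiset.map_congr rfl fun C _ => Subtype.ext ?_
  rw [Function.comp_apply, hf, component, of_eq_of_iff]
  refine MultiDigraph.restrict_isomorphic_restrict (e := Equiv.refl V) rfl fun v => ?_
  rw [Equiv.refl_apply, ← hψ, ψ.apply_eq_iff_eq]

theorem componentsOf_congr {hD : D.IsRegular k} {hE : E.IsRegular k} (h : D.Isomorphic E) :
    componentsOf D hD = componentsOf E hE := by
  classical
  obtain ⟨e, he⟩ := MultiDigraph.isomorphic_iff_adjMatrix.1 h
  have hκ : D.IsLocallyConstant fun v => E.underlyingGraph.connectedComponentMk (e v) := by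
    intro u v huv
    apply E.isLocallyConstant_connectedComponentMk
    rwa [← MultiDigraph.adjMatrix_ne_zero, ← he, Matrix.submatrix_apply,
      MultiDigraph.adjMatrix_ne_zero] at huv
  refine componentsOf_eq hκ _ fun C => ?_
  rw [component, of_eq_of_iff]
  exact (MultiDigraph.restrict_isomorphic_restrict he fun v => Iff.rfl).symm

/-- The classes of the weakly connected components of an isomorphism class. -/
noncomputable def components (q : RegularDigraphClass k) : Multiset (Connected k) :=
  Quotient.lift (fun D => componentsOf D.1 D.2)
    (fun D E h => componentsOf_congr (hD := D.2) (hE := E.2) h) q.2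

theorem components_of (hD : D.IsRegular k) : (of D hD).components = componentsOf D hD :=
  componentsOf_congr (MultiDigraph.Isomorphic.symm ⟨_, rfl⟩)

theorem card_components (q : RegularDigraphClass k) : q.components.card = q.numComponents := by
  obtain ⟨n, D, hD, rfl⟩ := q.exists_of_eq
  classical
  rw [components_of, numComponents_of, componentsOf, Multiset.card_map,
    MultiDigraph.numComponents, Nat.card_eq_fintype_card]
  rfl

theorem sum_size_components (q : RegularDigraphClass k) :
    (q.components.map fun c => c.1.size).sum = q.size := by
  obtain ⟨n, D, hD, rfl⟩ := q.exists_of_eq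
  classical
  rw [components_of, size_of, componentsOf, Multiset.map_map,
    ← Fintype.card_congr (Equiv.sigmaFiberEquiv D.underlyingGraph.connectedComponentMk),
    Fintype.card_sigma]
  rfl

theorem components_injective : Function.Injective (components (k := k)) := by
  classical
  intro q q' h
  obtain ⟨n, D, hD, rfl⟩ := q.exists_of_eq
  obtain ⟨m, E, hE, rfl⟩ := q'.exists_of_eq
  rw [components_of, components_of] at h
  obtain ⟨ψ, hψ⟩ := exists_equiv_comp_eq_of_map_univ_eq h
  refine of_eq_of_iff.2 (D.isLocallyConstant_connectedComponentMk.isomorphic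
    E.isLocallyConstant_connectedComponentMk ψ fun C => ?_)
  have hC : (component D hD C).1 = (component E hE (ψ C)).1 :=
    congrArg Subtype.val (congrFun hψ C).symm
  rwa [component, component, of_eq_of_iff] at hC

theorem components_surjective : Function.Surjective (components (k := k)) := by
  classical
  intro s
  choose m E hE hof using fun c : s => c.1.1.exists_of_eq
  have hD : (MultiDigraph.sigma E).IsRegular k :=
    (MultiDigraph.isLocallyConstant_sigma E).isRegular_iff.2 fun c =>
      (hE c).of_isomorphic (MultiDigraph.isomorphic_restrict_sigma E c)
  refine ⟨of _ hD, ?_⟩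
  rw [components_of, componentsOf_eq (MultiDigraph.isLocallyConstant_sigma E) (fun c : s => c.1),
    Multiset.map_univ_coe]
  intro c
  rw [← hof c, of_eq_of_iff]
  exact MultiDigraph.isomorphic_restrict_sigma E c

theorem card_connected_size_eq (k n : ℕ) :
    Nat.card {c : Connected k // c.1.size = n} = numUnlabeledComponents k n 1 :=
  Nat.card_congr (((Equiv.subtypeSubtypeEquivSubtypeInter _ _).trans
    (Equiv.subtypeEquivRight fun _ => And.comm)).trans
    ((Equiv.subtypeSubtypeEquivSubtypeInter _ _).symm.trans
      ((Equiv.sigmaSubtype n).subtypeEquiv (by rintro ⟨⟨_, x⟩, rfl⟩; rfl))))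

/-- The sizes of the components of an unlabeled digraph on `n` nodes. -/
noncomputable def componentPartition {n : ℕ} (x : UnlabeledRegularDigraph k n) : n.Partition where
  parts := (components ⟨n, x⟩).map fun c => c.1.size
  parts_pos h := by
    obtain ⟨c, -, rfl⟩ := Multiset.mem_map.1 h
    exact c.one_le_size
  parts_sum := sum_size_components ⟨n, x⟩

theorem card_parts_componentPartition {n : ℕ} (x : UnlabeledRegularDigraph k n) :
    (componentPartition x).parts.card = x.numComponents :=
  (Multiset.card_map _ _).trans (card_components ⟨n, x⟩)

end RegularDigraphClass

/-! ### Euler transform -/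

section Fibers

variable {α β : Type*} {f : α → β} {T : Finset β}

/-- The multiset with prescribed parts in the fibers of `f` over `T`. -/
def unionOfFibers (t : ∀ b : T, Multiset {a // f a = b}) : Multiset α :=
  ∑ b, (t b).map Subtype.val

theorem map_unionOfFibers (t : ∀ b : T, Multiset {a // f a = b}) :
    (unionOfFibers t).map f = ∑ b, Multiset.replicate (t b).card b.1 := by
  rw [unionOfFibers, ← Multiset.coe_mapAddMonoidHom, map_sum]
  refine Finset.sum_congr rfl fun b _ => ?_
  rw [Multiset.coe_mapAddMonoidHom, Multiset.map_map, Multiset.map_congr rfl fun a _ => a.2,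
    Multiset.map_const']

theorem count_unionOfFibers [DecidableEq α] (t : ∀ b : T, Multiset {a // f a = b}) {b : T}
    (a : {a // f a = b}) : (unionOfFibers t).count a.1 = (t b).count a := by
  rw [unionOfFibers, Multiset.count_sum', Finset.sum_eq_single b]
  · exact Multiset.count_map_eq_count' _ _ Subtype.val_injective a
  · rintro c - hc
    refine Multiset.count_eq_zero.2 fun ha => hc (Subtype.ext ?_)
    obtain ⟨x, -, hx⟩ := Multiset.mem_map.1 ha
    rw [← a.2, ← x.2, hx]
  · simp

theorem unionOfFibers_injective :
    Function.Injective (unionOfFibers : (∀ b : T, Multiset {a // f a = b}) → Multiset α) := by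
  classical
  refine fun t t' h => funext fun b => Multiset.ext.2 fun a => ?_
  rw [← count_unionOfFibers, ← count_unionOfFibers, h]

theorem exists_unionOfFibers_eq {s : Multiset α} (hs : ∀ a ∈ s, f a ∈ T) :
    ∃ t : ∀ b : T, Multiset {a // f a = b}, unionOfFibers t = s := by
  classical
  have hlift (b : T) : ∃ t : Multiset {a // f a = b}, t.map Subtype.val = s.filter (f · = b) :=
    CanLift.prf _ fun a ha => (Multiset.mem_filter.1 ha).2
  choose t ht using hlift
  refine ⟨t, Multiset.ext.2 fun a => ?_⟩
  simp only [unionOfFibers, ht, Multiset.count_sum', Multiset.count_filter]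
  rw [Finset.sum_coe_sort T fun b => if f a = b then s.count a else 0, Finset.sum_ite_eq,
    ite_eq_left_iff]
  exact fun ha => (Multiset.count_eq_zero.2 fun has => ha (hs a has)).symm

variable [DecidableEq β]

theorem count_map_unionOfFibers (t : ∀ b : T, Multiset {a // f a = b}) (b : T) :
    ((unionOfFibers t).map f).count b.1 = (t b).card := by
  simp [map_unionOfFibers, Multiset.count_sum', Multiset.count_replicate]

theorem natCard_map_eq (f : α → β) (μ : Multiset β) :
    Nat.card {s : Multiset α // s.map f = μ} =
      ∏ b ∈ μ.toFinset, (Nat.card {a // f a = b}).multichoose (μ.count b) := by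
  have hμ (t : ∀ b : μ.toFinset, Sym {a // f a = b} (μ.count b.1)) :
      (unionOfFibers fun b => (t b).1).map f = μ := by
    simp only [map_unionOfFibers, (t _).2, ← Multiset.nsmul_singleton]
    rw [Finset.sum_coe_sort μ.toFinset fun b => μ.count b • ({b} : Multiset β),
      Multiset.toFinset_sum_count_nsmul_eq]
  rw [← Finset.prod_coe_sort]
  simp only [← Sym.natCard_sym_eq_multichoose]
  rw [← Nat.card_pi]
  refine (Nat.card_congr (Equiv.ofBijective (fun t => ⟨_, hμ t⟩) ⟨fun t t' h => ?_, ?_⟩)).symm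
  · have hfibers := unionOfFibers_injective (congrArg Subtype.val h)
    exact funext fun b => Subtype.ext (congrFun hfibers b)
  · rintro ⟨s, hs⟩
    obtain ⟨t, rfl⟩ := exists_unionOfFibers_eq (f := f) (T := μ.toFinset) (s := s)
      fun a ha => by simpa [← hs] using ⟨a, ha, rfl⟩
    exact ⟨fun b => ⟨t b, by rw [← count_map_unionOfFibers, hs]⟩, rfl⟩

end Fibers

/-- The number of multisets of objects whose sizes form the multiset `s`, if there are `a l` objects
of size `l`. -/
def numMultisetsOfSizes (a : ℕ → ℕ) (s : Multiset ℕ) : ℕ :=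
  ∏ l ∈ s.toFinset, (a l).multichoose (s.count l)

theorem numMultisetsOfSizes_congr {a b : ℕ → ℕ} {s : Multiset ℕ} (h : ∀ l ∈ s, a l = b l) :
    numMultisetsOfSizes a s = numMultisetsOfSizes b s :=
  Finset.prod_congr rfl fun l hl => by rw [h l (Multiset.mem_toFinset.1 hl)]

/-- The Euler transform: the number of multisets of objects of total size `n`, if there are `a l`
objects of size `l`. -/
def eulerTransform (a : ℕ → ℕ) (n : ℕ) : ℕ :=
  ∑ p : n.Partition, numMultisetsOfSizes a p.parts

theorem lt_of_mem_parts_of_ne_indiscrete {n l : ℕ} {p : n.Partition}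
    (hp : p ≠ Nat.Partition.indiscrete n) (hl : l ∈ p.parts) : l < n := by
  refine (Nat.Partition.le_of_mem_parts hl).lt_of_ne ?_
  rintro rfl
  obtain ⟨t, ht⟩ := Multiset.exists_cons_of_mem hl
  have hsum : t.sum = 0 := by simpa [ht] using p.parts_sum
  have ht0 : t = 0 := Multiset.eq_zero_of_forall_notMem fun x hx =>
    (p.parts_pos (ht ▸ Multiset.mem_cons_of_mem hx)).ne' (Multiset.sum_eq_zero_iff.1 hsum x hx)
  refine hp (Nat.Partition.ext ?_)
  rw [ht, ht0, Nat.Partition.indiscrete_parts (p.parts_pos hl).ne']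
  rfl

theorem eulerTransform_eq_add {n : ℕ} (hn : n ≠ 0) (a : ℕ → ℕ) :
    eulerTransform a n = a n + ∑ p ∈ Finset.univ.erase (Nat.Partition.indiscrete n),
      numMultisetsOfSizes a p.parts := by
  rw [eulerTransform, ← Finset.add_sum_erase _ _ (Finset.mem_univ (Nat.Partition.indiscrete n)),
    Nat.Partition.indiscrete_parts hn]
  simp [numMultisetsOfSizes]

theorem eq_of_eulerTransform_eq {a b : ℕ → ℕ} {N : ℕ}
    (h : ∀ n ≤ N, eulerTransform a n = eulerTransform b n) {n : ℕ} (hn : n ≠ 0) (hnN : n ≤ N) :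
    a n = b n := by
  induction n using Nat.strong_induction_on with
  | _ n ih =>
    have htransform := h n hnN
    rw [eulerTransform_eq_add hn, eulerTransform_eq_add hn] at htransform
    refine Nat.add_right_cancel (htransform.trans (congrArg _ ?_))
    refine Finset.sum_congr rfl fun p hp => (numMultisetsOfSizes_congr fun l hl => ?_).symm
    have hln := lt_of_mem_parts_of_ne_indiscrete (Finset.ne_of_mem_erase hp) hl
    exact ih l hln (p.parts_pos hl).ne' (hln.le.trans hnN)

namespace RegularDigraphClass

variable {k n : ℕ}

theorem natCard_componentPartition_eq (p : n.Partition) :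
    Nat.card {x : UnlabeledRegularDigraph k n // componentPartition x = p} =
      numMultisetsOfSizes (numUnlabeledComponents k · 1) p.parts := by
  simp only [numMultisetsOfSizes, ← card_connected_size_eq]
  rw [← natCard_map_eq]
  refine Nat.card_congr (Equiv.ofBijective
    (fun x => ⟨components ⟨n, x.1⟩, congrArg Nat.Partition.parts x.2⟩) ⟨fun x y h => ?_, ?_⟩)
  · have hxy := components_injective (congrArg Subtype.val h)
    exact Subtype.ext (eq_of_heq (Sigma.mk.inj hxy).2)
  · rintro ⟨s, hs⟩
    obtain ⟨⟨m, x⟩, rfl⟩ := components_surjective s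
    obtain rfl : m = n := by rw [← p.parts_sum, ← hs, sum_size_components]
    exact ⟨⟨x, Nat.Partition.ext hs⟩, rfl⟩

theorem natCard_subtype_componentPartition (P : n.Partition → Prop) [DecidablePred P] :
    Nat.card {x : UnlabeledRegularDigraph k n // P (componentPartition x)} =
      ∑ p with P p, numMultisetsOfSizes (numUnlabeledComponents k · 1) p.parts := by
  rw [← Nat.card_congr (Equiv.sigmaSubtypeFiberEquivSubtype componentPartition fun x => Iff.rfl),
    Nat.card_sigma]
  exact (Finset.sum_congr rfl fun p _ => natCard_componentPartition_eq p.1).trans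
    (Finset.sum_subtype _ (fun p => Finset.mem_filter_univ p) _).symm

end RegularDigraphClass

theorem numUnlabeledComponents_eq_sum (k n c : ℕ) :
    numUnlabeledComponents k n c = ∑ p : n.Partition with p.parts.card = c,
      numMultisetsOfSizes (numUnlabeledComponents k · 1) p.parts := by
  rw [← RegularDigraphClass.natCard_subtype_componentPartition fun p => p.parts.card = c]
  simp only [RegularDigraphClass.card_parts_componentPartition]
  rfl

theorem numUnlabeled_eq_eulerTransform (k n : ℕ) :
    numUnlabeled k n = eulerTransform (numUnlabeledComponents k · 1) n := by
  have h := RegularDigraphClass.natCard_subtype_componentPartition (k := k) (n := n) fun _ => True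
  rwa [Nat.card_congr (Equiv.subtypeUnivEquiv fun _ => trivial), Finset.filter_true] at h

theorem numUnlabeled_eq_sum_numUnlabeledComponents (k : ℕ) {n : ℕ} (hn : n ≠ 0) :
    numUnlabeled k n = ∑ c ∈ Finset.Icc 1 n, numUnlabeledComponents k n c := by
  have hcard (p : n.Partition) : p.parts.card ∈ Finset.Icc 1 n := by
    refine Finset.mem_Icc.2 ⟨Multiset.card_pos.2 fun h => hn ?_, ?_⟩
    · rw [← p.parts_sum, h, Multiset.sum_zero]
    · simpa [p.parts_sum] using p.parts.card_nsmul_le_sum fun l hl => p.parts_pos hl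
  simp only [numUnlabeled_eq_eulerTransform, numUnlabeledComponents_eq_sum k n]
  exact (Finset.sum_fiberwise_of_maps_to (fun p _ => hcard p) _).symm

/-! ### Numerical evaluation -/

/-- The multisets of numbers in `{1, …, m}` with sum `n`, by recursion on `m`, splitting off the
copies of the largest part; unlike `Fintype (Nat.Partition n)`, it reduces well in the kernel. -/
def boundedPartitions : ℕ → ℕ → Finset (Multiset ℕ)
  | 0, n => if n = 0 then {0} else ∅
  | m + 1, n => (Finset.range (n / (m + 1) + 1)).biUnion fun j =>
      (boundedPartitions m (n - j * (m + 1))).image (Multiset.replicate j (m + 1) + ·)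

theorem mem_boundedPartitions {m n : ℕ} {s : Multiset ℕ} :
    s ∈ boundedPartitions m n ↔ (∀ x ∈ s, 1 ≤ x ∧ x ≤ m) ∧ s.sum = n := by
  induction m generalizing n s with
  | zero =>
    have hs : (∀ x ∈ s, 1 ≤ x ∧ x ≤ 0) ↔ s = 0 :=
      ⟨fun h => Multiset.eq_zero_of_forall_notMem fun x hx => by have := h x hx; omega,
        by rintro rfl; simp⟩
    rw [hs, boundedPartitions]
    split_ifs with hn
    · simp +contextual [hn]
    · simp +contextual [Ne.symm hn]
  | succ m ih =>
    simp only [boundedPartitions, Finset.mem_biUnion, Finset.mem_range, Finset.mem_image, ih,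
      Nat.lt_succ_iff, Nat.le_div_iff_mul_le m.add_one_pos]
    constructor
    · rintro ⟨j, hj, t, ⟨ht, hsum⟩, rfl⟩
      refine ⟨fun x hx => ?_, by simp [hsum, hj]⟩
      rcases Multiset.mem_add.1 hx with hx | hx
      · simp [Multiset.eq_of_mem_replicate hx]
      · exact ⟨(ht x hx).1, (ht x hx).2.trans m.le_succ⟩
    · rintro ⟨hs, rfl⟩
      have hsplit : Multiset.replicate (s.count (m + 1)) (m + 1) + s.filter (· ≠ m + 1) = s := by
        rw [← Multiset.filter_eq', Multiset.filter_add_not]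
      have hsum := congrArg Multiset.sum hsplit
      rw [Multiset.sum_add, Multiset.sum_replicate, smul_eq_mul] at hsum
      refine ⟨s.count (m + 1), by omega, s.filter (· ≠ m + 1), ⟨fun x hx => ?_, by omega⟩, hsplit⟩
      obtain ⟨hxs, hxm⟩ := Multiset.mem_filter.1 hx
      exact ⟨(hs x hxs).1, Nat.le_of_lt_succ ((hs x hxs).2.lt_of_ne hxm)⟩

theorem sum_partition_eq_sum_boundedPartitions {M : Type*} [AddCommMonoid M] (n : ℕ)
    (g : Multiset ℕ → M) :
    ∑ p : n.Partition, g p.parts = ∑ s ∈ boundedPartitions n n, g s :=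
  Finset.sum_bij (fun p _ => p.parts)
    (fun p _ => mem_boundedPartitions.2
      ⟨fun _ hx => ⟨p.parts_pos hx, Nat.Partition.le_of_mem_parts hx⟩, p.parts_sum⟩)
    (fun _ _ _ _ h => Nat.Partition.ext h)
    (fun s hs => ⟨⟨s, fun hx => ((mem_boundedPartitions.1 hs).1 _ hx).1,
      (mem_boundedPartitions.1 hs).2⟩, Finset.mem_univ _, rfl⟩)
    fun _ _ => rfl

/-- The form in which these numbers are evaluated: `Nat.multichoose` recurses on `a l`, which is far
too slow for the numbers of connected digraphs. -/
theorem numMultisetsOfSizes_eq_prod_descFactorial (a : ℕ → ℕ) (s : Multiset ℕ) :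
    numMultisetsOfSizes a s =
      ∏ l ∈ s.toFinset, (a l + s.count l - 1).descFactorial (s.count l) / (s.count l).factorial :=
  Finset.prod_congr rfl fun _ _ => by
    rw [Nat.multichoose_eq, Nat.choose_eq_descFactorial_div_factorial]

/-- The numbers of connected unlabeled `2`-regular digraphs on `n ≤ 9` nodes, found by inverting the
Euler transform (junk value `0` for `n > 9`). The value at `0` is irrelevant, since parts of
partitions are positive. -/
def connectedCount (n : ℕ) : ℕ :=
  [0, 1, 2, 5, 14, 50, 265, 1601, 11984, 101884].getD n 0

set_option maxRecDepth 10000 in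
theorem sum_doubleCoverFixedPoints_eq_sum_numMultisetsOfSizes :
    ∀ n ∈ Finset.range 10,
      ∑ s ∈ boundedPartitions n n, n.factorial / centralizerOrder s * doubleCoverFixedPoints s =
        (∑ s ∈ boundedPartitions n n, numMultisetsOfSizes connectedCount s) *
          (n.factorial * 4 ^ n) := by
  simp only [numMultisetsOfSizes_eq_prod_descFactorial]
  decide +kernel

theorem numUnlabeled_two {n : ℕ} (hn : n ≤ 9) :
    numUnlabeled 2 n = ∑ s ∈ boundedPartitions n n, numMultisetsOfSizes connectedCount s := by
  refine Nat.eq_of_mul_eq_mul_right (by positivity : 0 < n.factorial * 4 ^ n) ?_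
  rw [numUnlabeled_two_mul, sum_partition_eq_sum_boundedPartitions n fun s =>
    n.factorial / centralizerOrder s * doubleCoverFixedPoints s]
  exact sum_doubleCoverFixedPoints_eq_sum_numMultisetsOfSizes n (Finset.mem_range_succ_iff.2 hn)

theorem numUnlabeledComponents_two_one {n : ℕ} (hn : n ≠ 0) (hn9 : n ≤ 9) :
    numUnlabeledComponents 2 n 1 = connectedCount n :=
  eq_of_eulerTransform_eq (a := (numUnlabeledComponents 2 · 1))
    (fun m hm => by rw [← numUnlabeled_eq_eulerTransform, numUnlabeled_two hm, eulerTransform,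
      sum_partition_eq_sum_boundedPartitions])
    hn hn9

theorem numUnlabeledComponents_two {n : ℕ} (hn : n ≤ 9) (c : ℕ) :
    numUnlabeledComponents 2 n c =
      ∑ s ∈ boundedPartitions n n with s.card = c, numMultisetsOfSizes connectedCount s := by
  rw [numUnlabeledComponents_eq_sum, Finset.sum_filter, Finset.sum_filter,
    ← sum_partition_eq_sum_boundedPartitions]
  refine Finset.sum_congr rfl fun p _ => ?_
  rw [numMultisetsOfSizes_congr fun l hl => numUnlabeledComponents_two_one (p.parts_pos hl).ne'
    ((Nat.Partition.le_of_mem_parts hl).trans hn)]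

theorem mainTheorem1 :
    -- the table of `U_2(n, c)`, rows `n = 1, …, 9`, columns `c = 1, …, 9`; blanks are zeros
    (∀ n c : Fin 9, numUnlabeledComponents 2 (n.val + 1) (c.val + 1) =
      (!![     1,     0,    0,   0,   0,  0, 0, 0, 0;
               2,     1,    0,   0,   0,  0, 0, 0, 0;
               5,     2,    1,   0,   0,  0, 0, 0, 0;
              14,     8,    2,   1,   0,  0, 0, 0, 0;
              50,    24,    8,   2,   1,  0, 0, 0, 0;
             265,    93,   28,   8,   2,  1, 0, 0, 0;
            1601,   435,  108,  28,   8,  2, 1, 0, 0;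
           11984,  2486,  507, 113,  28,  8, 2, 1, 0;
          101884, 17211, 2811, 527, 113, 28, 8, 2, 1] : Matrix (Fin 9) (Fin 9) ℕ) n c) ∧
    -- the last column of the table
    (∀ n : Fin 9, numUnlabeled 2 (n.val + 1) =
      (![1, 3, 8, 25, 85, 397, 2183, 15129, 122585] : Fin 9 → ℕ) n) ∧
    -- the last column consists of the row sums
    (∀ n : Fin 9, numUnlabeled 2 (n.val + 1) =
      ∑ c ∈ Finset.Icc 1 (n.val + 1), numUnlabeledComponents 2 (n.val + 1) c) ∧
    -- taking adjacency matrices identifies unlabeled digraphs with orbits of matrices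
    (∀ n : ℕ, ∃ f : UnlabeledRegularDigraph 2 n ≃ RegularMatrixOrbit 2 n,
      ∀ D : LabeledRegularDigraph 2 n,
        f (Quotient.mk (LabeledRegularDigraph.isoSetoid 2 n) D) =
          Quotient.mk (MulAction.orbitRel (Equiv.Perm (Fin n)) (RegularMatrix 2 n)) D.toMatrix) ∧
    -- the same numbers count the orbits of matrices
    (∀ n : Fin 9, Nat.card (RegularMatrixOrbit 2 (n.val + 1)) =
      (![1, 3, 8, 25, 85, 397, 2183, 15129, 122585] : Fin 9 → ℕ) n) := by
  have htotal : ∀ n : Fin 9, numUnlabeled 2 (n.val + 1) =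
      (![1, 3, 8, 25, 85, 397, 2183, 15129, 122585] : Fin 9 → ℕ) n := by
    intro n
    simp only [numUnlabeled_two n.isLt, numMultisetsOfSizes_eq_prod_descFactorial]
    revert n
    decide +kernel
  have horbit := exists_equiv_regularMatrixOrbit 2
  refine ⟨?_, htotal, fun n => numUnlabeled_eq_sum_numUnlabeledComponents 2 n.val.succ_ne_zero,
    horbit, fun n => ?_⟩
  · intro n
    simp only [numUnlabeledComponents_two n.isLt, numMultisetsOfSizes_eq_prod_descFactorial]
    fin_cases n <;> decide +kernel
  · obtain ⟨f, -⟩ := horbit (n.val + 1)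
    exact (Nat.card_congr f).symm.trans (htotal n)
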